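/- Let $0<H<1$ and let $B=\{B_t,\ t\ge 0\}$ be a one-dimensional fractional Brownian motion with Hurst parameter $H$, that is, a centred Gaussian process with covariance $R_H(t,s)=\mathbb{E}(B_tB_s)=\frac12\left(s^{2H}+t^{2H}-|t-s|^{2H}\right)$. For $T>0$ let $\mathcal{H}$ be the Hilbert space obtained by completing the step functions on $[0,T]$ for the scalar product $\langle \mathbf{1}_{[0,t]},\mathbf{1}_{[0,s]}\rangle_{\mathcal H}=R_H(t,s)$, and let $\varphi\mapsto B(\varphi)$ be the linear isometry from $\mathcal H$ into $L^2(\Omega)$ with $B(\mathbf 1_{[0,t]})=B_t$. For $n\ge 0$ and $g\in\mathcal{H}^{\otimes n}$ let $I_n(g)$ denote the multiple Wiener integral of $g$ with respect to $B$, i.e. the element of $L^2(\Omega,\sigma(B_s,\,s\le T))$ determined by $\mathbb{E}(F\,I_n(g))=\mathbb{E}\langle D^nF,g\rangle_{\mathcal{H}^{\otimes n}}$ for all $F=f(B(\varphi_1),\dots,B(\varphi_m))$ with $\varphi_i\in\mathcal H$ and $f$ smooth and bounded with all its derivatives, where $D^nF=\sum_{i_1,\dots,i_n}\partial_{i_1}\cdots\partial_{i_n}f(B(\varphi_1),\dots,B(\varphi_m))\,\varphi_{i_1}\otimes\cdots\otimes\varphi_{i_n}$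 is the $n$-th Malliavin derivative. The $n$-th Wiener chaos is the set of all $I_n(g)$, $g\in\mathcal H^{\otimes n}$. Then for every $0<t\le T$ the integrals $I_n(\mathbf 1_{[0,t]}^{\otimes n})$, $n\ge0$, exist and are unique, and $$\mathrm{sign}(B_t)=\sum_{k=0}^{\infty} b_{2k+1}\,I_{2k+1}\!\left(\mathbf 1_{[0,t]}^{\otimes(2k+1)}\right),\qquad b_{2k+1}=\frac{2(-1)^k}{(2k+1)\sqrt{2\pi}\;t^{(2k+1)H}\,k!\,2^k},$$ where the series converges in $L^2(\Omega)$. In particular only chaoses of odd order appear: $\mathrm{sign}(B_t)$ is orthogonal in $L^2(\Omega)$ to every Wiener chaos of even order. -/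

import Mathlib

open MeasureTheory ProbabilityTheory
open scoped NNReal ENNReal

noncomputable section

namespace FBM

/-- The covariance function of fractional Brownian motion with Hurst parameter `H`:
`R_H(t, s) = (s^{2H} + t^{2H} - |t - s|^{2H}) / 2`. -/
def cov (H : ℝ) (t s : ℝ≥0) : ℝ :=
  ((s : ℝ) ^ (2 * H) + (t : ℝ) ^ (2 * H) - |(t : ℝ) - (s : ℝ)| ^ (2 * H)) / 2

/-- `B` is a fractional Brownian motion with Hurst parameter `H`: a centred Gaussian process
with covariance `R_H`. -/
structure IsFBM {Ω : Type*} [MeasurableSpace Ω] (H : ℝ) (B : ℝ≥0 → Ω → ℝ) (P : Measure Ω) :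
    Prop where
  measurable : ∀ t, Measurable (B t)
  gaussian : IsGaussianProcess B P
  mean_zero : ∀ t, ∫ ω, B t ω ∂P = 0
  covariance : ∀ t s, ∫ ω, B t ω * B s ω ∂P = cov H t s

variable {Ω : Type*} [MeasurableSpace Ω]

/-- The Hilbert space `𝓗` of the process on `[0, T]`: the completion of the step functions for the
scalar product `⟨1_{[0,t]}, 1_{[0,s]}⟩ = E(B_t B_s)`. It is realised through the isometry
`φ ↦ B(φ)`, as the closed linear span of `{B_s : s ∈ [0, T]}` in `L²(P)`: the function `1_{[0,s]}`
is the class of `B_s`, and an element `φ` of this space, read as a random variable, is the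
Wiener integral `B(φ)`. See `IsFBM.inner_ind` for the scalar product. -/
def hilb (B : ℝ≥0 → Ω → ℝ) (P : Measure Ω) (T : ℝ≥0) : Submodule ℝ (Lp ℝ 2 P) :=
  (Submodule.span ℝ {X : Lp ℝ 2 P | ∃ s ≤ T, X =ᵐ[P] B s}).topologicalClosure

/-- The sigma-algebra generated by `{B_s : s ∈ [0, T]}`. -/
abbrev sigmaAlg (B : ℝ≥0 → Ω → ℝ) (T : ℝ≥0) : MeasurableSpace Ω :=
  ⨆ s : Set.Iic T, MeasurableSpace.comap (B s) inferInstance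

theorem memLp_tensor (P : Measure Ω) [IsProbabilityMeasure P] {n : ℕ}
    (φ : Fin n → Lp ℝ 2 P) :
    MemLp (fun x : Fin n → Ω => ∏ j, φ j (x j)) 2 (Measure.pi fun _ : Fin n => P) := by
  rw [memLp_two_iff_integrable_sq]
  · simp_rw [← Finset.prod_pow]
    exact Integrable.fintype_prod (f := fun j ω => (φ j ω) ^ 2)
      fun j => (Lp.memLp (φ j)).integrable_sq
  · have h : ∀ j, AEStronglyMeasurable (fun x : Fin n → Ω => φ j (x j))
        (Measure.pi fun _ : Fin n => P) := fun j =>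
      (Lp.aestronglyMeasurable (φ j)).comp_quasiMeasurePreserving
        (Measure.quasiMeasurePreserving_eval _ j)
    exact Finset.aestronglyMeasurable_fun_prod _ fun j _ => h j

/-- The elementary tensor `φ₁ ⊗ ⋯ ⊗ φₙ` of elements of `L²(P)`, as an element of `L²(Pⁿ)`. -/
def tensorLp (P : Measure Ω) [IsProbabilityMeasure P] {n : ℕ} (φ : Fin n → Lp ℝ 2 P) :
    Lp ℝ 2 (Measure.pi fun _ : Fin n => P) :=
  (memLp_tensor P φ).toLp _

/-- The scalar product of elementary tensors is the product of the scalar products. -/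
theorem inner_tensorLp (P : Measure Ω) [IsProbabilityMeasure P] {n : ℕ}
    (φ ψ : Fin n → Lp ℝ 2 P) :
    inner ℝ (tensorLp P φ) (tensorLp P ψ) = ∏ j, inner ℝ (φ j) (ψ j) := by
  simp_rw [L2.inner_def]
  refine Eq.trans ?_ (integral_fintype_prod_eq_prod (μ := fun _ : Fin n => P)
    (fun j ω => (inner ℝ (φ j ω) (ψ j ω) : ℝ)))
  refine integral_congr_ae ?_
  filter_upwards [(memLp_tensor P φ).coeFn_toLp, (memLp_tensor P ψ).coeFn_toLp] with x h1 h2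
  simp only [tensorLp, h1, h2]
  simp [Finset.prod_mul_distrib]

/-- The Hilbert tensor power `𝓗^{⊗ n}`: the closed linear span of the elementary tensors of
elements of `𝓗`, inside `L²(P)^{⊗ n} = L²(Pⁿ)`. -/
def tensorPow (B : ℝ≥0 → Ω → ℝ) (P : Measure Ω) [IsProbabilityMeasure P] (T : ℝ≥0) (n : ℕ) :
    Submodule ℝ (Lp ℝ 2 (Measure.pi fun _ : Fin n => P)) :=
  (Submodule.span ℝ (Set.range fun φ : Fin n → hilb B P T =>
    tensorLp P fun j => (φ j : Lp ℝ 2 P))).topologicalClosure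

/-- The elementary tensor `φ₁ ⊗ ⋯ ⊗ φₙ` of elements of `𝓗`, in `𝓗^{⊗ n}`. -/
def tensor {B : ℝ≥0 → Ω → ℝ} {P : Measure Ω} [IsProbabilityMeasure P] {T : ℝ≥0} {n : ℕ}
    (φ : Fin n → hilb B P T) : tensorPow B P T n :=
  ⟨tensorLp P fun j => (φ j : Lp ℝ 2 P),
    Submodule.le_topologicalClosure _ (Submodule.subset_span ⟨φ, rfl⟩)⟩

/-- A smooth cylindrical random variable `F = f(B(φ₁), …, B(φₘ))`, with `φᵢ ∈ 𝓗` and `f` smooth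
and bounded together with all its derivatives. -/
structure SmoothCyl (B : ℝ≥0 → Ω → ℝ) (P : Measure Ω) (T : ℝ≥0) where
  m : ℕ
  f : (Fin m → ℝ) → ℝ
  φ : Fin m → hilb B P T
  smooth : ContDiff ℝ (⊤ : ℕ∞) f
  bounded : ∀ k : ℕ, ∃ C : ℝ, ∀ x, ‖iteratedFDeriv ℝ k f x‖ ≤ C

namespace SmoothCyl

variable {B : ℝ≥0 → Ω → ℝ} {P : Measure Ω} {T : ℝ≥0}

/-- The vector `(B(φ₁), …, B(φₘ))`. -/
def point (F : SmoothCyl B P T) (ω : Ω) : Fin F.m → ℝ :=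
  fun i => (F.φ i : Lp ℝ 2 P) ω

/-- The value `F(ω) = f(B(φ₁)(ω), …, B(φₘ)(ω))`. -/
def val (F : SmoothCyl B P T) (ω : Ω) : ℝ := F.f (F.point ω)

/-- The `n`-th Malliavin derivative
`DⁿF = ∑_{i₁, …, iₙ} (∂_{i₁} ⋯ ∂_{iₙ} f)(B(φ₁), …, B(φₘ)) φ_{i₁} ⊗ ⋯ ⊗ φ_{iₙ}`. -/
def malliavin [IsProbabilityMeasure P] (F : SmoothCyl B P T) (n : ℕ) (ω : Ω) :
    tensorPow B P T n :=
  ∑ i : Fin n → Fin F.m,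
    iteratedFDeriv ℝ n F.f (F.point ω) (fun j => Pi.single (i j) (1 : ℝ)) •
      tensor fun j => F.φ (i j)

end SmoothCyl

/-- `G = Iₙ(g)`, the multiple Wiener integral of order `n` of the kernel `g ∈ 𝓗^{⊗ n}` with respect
to `B`, i.e. the `n`-fold divergence of the deterministic kernel `g`: `G` is a square integrable
functional of `(B_s)_{s ≤ T}` and `E(F G) = E⟨DⁿF, g⟩` for every smooth cylindrical `F`. -/
def IsMultipleIntegral (B : ℝ≥0 → Ω → ℝ) (P : Measure Ω) [IsProbabilityMeasure P] (T : ℝ≥0)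
    (n : ℕ) (g : tensorPow B P T n) (G : Lp ℝ 2 P) : Prop :=
  AEStronglyMeasurable[sigmaAlg B T] G P ∧
    ∀ F : SmoothCyl B P T, ∫ ω, F.val ω * G ω ∂P = ∫ ω, inner ℝ (F.malliavin n ω) g ∂P

open Classical in
/-- The multiple Wiener integral `Iₙ(g)` (with value `0` if there is none). -/
def multipleIntegral (B : ℝ≥0 → Ω → ℝ) (P : Measure Ω) [IsProbabilityMeasure P] (T : ℝ≥0)
    (n : ℕ) (g : tensorPow B P T n) : Lp ℝ 2 P :=
  if h : ∃ G, IsMultipleIntegral B P T n g G then h.choose else 0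

/-- The `n`-th Wiener chaos: all multiple Wiener integrals of order `n`. -/
def chaos (B : ℝ≥0 → Ω → ℝ) (P : Measure Ω) [IsProbabilityMeasure P] (T : ℝ≥0) (n : ℕ) :
    Set (Lp ℝ 2 P) :=
  {G | ∃ g : tensorPow B P T n, IsMultipleIntegral B P T n g G}

namespace IsFBM

variable {H : ℝ} {B : ℝ≥0 → Ω → ℝ} {P : Measure Ω}

theorem memLp (hB : IsFBM H B P) (t : ℝ≥0) : MemLp (B t) 2 P :=
  (hB.gaussian.hasGaussianLaw_eval t).memLp_two

/-- The element `1_{[0,t]}` of `𝓗`, for `t ∈ [0, T]`. -/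
def ind (hB : IsFBM H B P) {t T : ℝ≥0} (htT : t ≤ T) : hilb B P T :=
  ⟨(hB.memLp t).toLp (B t), Submodule.le_topologicalClosure _
    (Submodule.subset_span ⟨t, htT, (hB.memLp t).coeFn_toLp⟩)⟩

/-- `⟨1_{[0,t]}, 1_{[0,s]}⟩ = R_H(t, s)` in `𝓗`. -/
theorem inner_ind (hB : IsFBM H B P) {t s T : ℝ≥0} (ht : t ≤ T) (hs : s ≤ T) :
    inner ℝ (hB.ind ht) (hB.ind hs) = cov H t s := by
  rw [← hB.covariance t s, Submodule.coe_inner, L2.inner_def]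
  refine integral_congr_ae ?_
  filter_upwards [(hB.memLp t).coeFn_toLp, (hB.memLp s).coeFn_toLp] with ω h1 h2
  simp only [ind, h1, h2]
  simp [mul_comm]

theorem memLp_sign [IsProbabilityMeasure P] (hB : IsFBM H B P) (t : ℝ≥0) :
    MemLp (fun ω => Real.sign (B t ω)) 2 P := by
  have hs : Measurable Real.sign := by
    unfold Real.sign
    exact Measurable.ite measurableSet_Iio measurable_const
      (Measurable.ite measurableSet_Ioi measurable_const measurable_const)
  refine MemLp.of_bound (hs.comp (hB.measurable t)).aestronglyMeasurable 1 ?_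
  refine Filter.Eventually.of_forall fun ω => ?_
  rcases Real.sign_apply_eq (B t ω) with h | h | h <;> simp [h]

/-- The random variable `sign(B_t)`, in `L²(P)`. -/
def sign [IsProbabilityMeasure P] (hB : IsFBM H B P) (t : ℝ≥0) : Lp ℝ 2 P :=
  (hB.memLp_sign t).toLp _

end IsFBM

/-- The coefficient `b_{2k+1} = 2 (-1)^k / ((2k+1) √(2π) t^{(2k+1)H} k! 2^k)`. -/
def coeff (H : ℝ) (t : ℝ≥0) (k : ℕ) : ℝ :=
  2 * (-1) ^ k /
    ((2 * k + 1) * √(2 * Real.pi) * (t : ℝ) ^ ((2 * k + 1) * H) * (k.factorial : ℝ) * 2 ^ k)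

end FBM

end

/-!
The Hermite polynomials `Heₙ` form an orthogonal basis of `L²` of the standard Gaussian measure.
For a unit vector `u` of `𝓗`, splitting each `B(φᵢ)` into `⟨φᵢ, u⟩ B(u)` and an independent part
and integrating by parts `n` times in the variable `B(u)` shows `Iₙ(u^{⊗ n}) = Heₙ(B(u))`. More
generally the conditional expectation of `Iₙ(g)` given `B(u)` is `⟨u^{⊗ n}, g⟩ Heₙ(B(u))`, because
it is determined by testing `Iₙ(g)` against the trigonometric functions of `B(u)`. The theorem is
thus the Hermite expansion of `sign`, which involves only odd degrees; its coefficients come from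
the boundary term in `∫_{x > 0} He_{n+1} dγ = Heₙ(0) / √(2π)`.
-/

namespace FBM

section

open Polynomial

local notation "γ" => gaussianReal 0 1

/-- The probabilists' Hermite polynomial `Heₙ`, with real coefficients. -/
noncomputable def realHermite (n : ℕ) : ℝ[X] := (hermite n).map (Int.castRingHom ℝ)

theorem realHermite_zero : realHermite 0 = 1 := by simp [realHermite]

theorem realHermite_succ (n : ℕ) :
    realHermite (n + 1) = X * realHermite n - derivative (realHermite n) := by
  simp [realHermite, hermite_succ, derivative_map]

theorem degree_realHermite (n : ℕ) : (realHermite n).degree = n := by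
  rw [realHermite, (hermite_monic n).degree_map, degree_hermite]

theorem coeff_realHermite_self (n : ℕ) : (realHermite n).coeff n = 1 := by
  simp [realHermite, coeff_map, coeff_hermite_self]

theorem eval_zero_realHermite_of_odd {n : ℕ} (hn : Odd n) : (realHermite n).eval 0 = 0 := by
  simp [realHermite, ← coeff_zero_eq_eval_zero, coeff_hermite_of_odd_add (k := 0) hn]

theorem eval_zero_realHermite_two_mul (k : ℕ) :
    (realHermite (2 * k)).eval 0 = (-1) ^ k * ((2 * k - 1).doubleFactorial : ℝ) := by
  simpa [realHermite, ← coeff_zero_eq_eval_zero] using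
    congrArg (Int.cast : ℤ → ℝ) (coeff_hermite_explicit k 0)

theorem span_range_realHermite : Submodule.span ℝ (Set.range realHermite) = ⊤ :=
  Polynomial.Sequence.span ⟨realHermite, degree_realHermite⟩ fun n =>
    IsUnit.mk0 _ (leadingCoeff_ne_zero.2 (Polynomial.Sequence.ne_zero _ n))

theorem hasDerivAt_gaussianPDFReal (x : ℝ) :
    HasDerivAt (gaussianPDFReal 0 1) (-x * gaussianPDFReal 0 1 x) x := by
  have h : HasDerivAt (fun y : ℝ => -(y - 0) ^ 2 / (2 * ((1 : ℝ≥0) : ℝ))) (-x) x := by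
    refine ((((hasDerivAt_id x).sub_const 0).pow 2).neg.div_const _).congr_deriv ?_
    simp
    ring
  rw [gaussianPDFReal_def]
  exact (h.exp.const_mul _).congr_deriv (by ring)

theorem hasDerivAt_realHermite_mul_gaussianPDFReal (n : ℕ) (x : ℝ) :
    HasDerivAt (fun y => (realHermite n).eval y * gaussianPDFReal 0 1 y)
      (-((realHermite (n + 1)).eval x * gaussianPDFReal 0 1 x)) x := by
  refine (((realHermite n).hasDerivAt x).mul (hasDerivAt_gaussianPDFReal x)).congr_deriv ?_
  simp only [realHermite_succ, eval_sub, eval_mul, eval_X]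
  ring

theorem integrable_gaussianReal_iff {f : ℝ → ℝ} :
    Integrable f γ ↔ Integrable fun x => f x * gaussianPDFReal 0 1 x := by
  rw [gaussianReal_of_var_ne_zero _ one_ne_zero, integrable_withDensity_iff_integrable_smul'
    (measurable_gaussianPDF 0 1) (.of_forall fun _ => gaussianPDF_lt_top)]
  simp [toReal_gaussianPDF, mul_comm]

theorem integrable_polynomial_eval_gaussianReal (m : ℝ) (v : ℝ≥0) (p : ℝ[X]) :
    Integrable (fun x => p.eval x) (gaussianReal m v) := by
  simp_rw [eval_eq_sum_range]
  refine integrable_finsetSum _ fun i _ => Integrable.const_mul ?_ _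
  have h : MemLp (id : ℝ → ℝ) i (gaussianReal m v) := memLp_id_gaussianReal' _ (by simp)
  exact h.integrable_norm_pow'.mono' (by fun_prop) (.of_forall fun x => by simp)

theorem memLp_polynomial_eval_gaussianReal (m : ℝ) (v : ℝ≥0) (p : ℝ[X]) :
    MemLp (fun x => p.eval x) 2 (gaussianReal m v) := by
  rw [memLp_two_iff_integrable_sq (by fun_prop)]
  simp_rw [← eval_pow]
  exact integrable_polynomial_eval_gaussianReal m v (p ^ 2)

theorem integral_deriv_mul_realHermite {h h' : ℝ → ℝ} (hd : ∀ x, HasDerivAt h (h' x) x)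
    (hh : MemLp h 2 γ) (hh' : MemLp h' 2 γ) (n : ℕ) :
    ∫ x, h' x * (realHermite n).eval x ∂γ = ∫ x, h x * (realHermite (n + 1)).eval x ∂γ := by
  have integrable_mul {f : ℝ → ℝ} (hf : MemLp f 2 γ) (k : ℕ) :
      Integrable fun x => f x * ((realHermite k).eval x * gaussianPDFReal 0 1 x) := by
    simpa only [Pi.mul_apply, mul_assoc] using integrable_gaussianReal_iff.1
      (hf.integrable_mul (memLp_polynomial_eval_gaussianReal 0 1 (realHermite k)))
  have parts := integral_mul_deriv_eq_deriv_mul_of_integrable (fun x _ => hd x)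
    (fun x _ => hasDerivAt_realHermite_mul_gaussianPDFReal n x)
    (by simpa [Pi.mul_def] using (integrable_mul hh (n + 1)).neg) (integrable_mul hh' n)
    (integrable_mul hh n)
  simp only [mul_neg, integral_neg, neg_inj] at parts
  simp only [integral_gaussianReal_eq_integral_smul one_ne_zero, smul_eq_mul]
  calc ∫ x, gaussianPDFReal 0 1 x * (h' x * (realHermite n).eval x)
      = ∫ x, h' x * ((realHermite n).eval x * gaussianPDFReal 0 1 x) := by congr! 2; ring
    _ = ∫ x, h x * ((realHermite (n + 1)).eval x * gaussianPDFReal 0 1 x) := parts.symm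
    _ = ∫ x, gaussianPDFReal 0 1 x * (h x * (realHermite (n + 1)).eval x) := by congr! 2; ring

theorem integral_mul_realHermite {h : ℝ → ℝ} (hs : ContDiff ℝ (⊤ : ℕ∞) h)
    (hh : ∀ k, MemLp (iteratedDeriv k h) 2 γ) (n : ℕ) :
    ∫ x, h x * (realHermite n).eval x ∂γ = ∫ x, iteratedDeriv n h x ∂γ := by
  have shift (n k : ℕ) : ∫ x, iteratedDeriv k h x * (realHermite n).eval x ∂γ =
      ∫ x, iteratedDeriv (k + n) h x ∂γ := by
    induction n generalizing k with
    | zero => simp [realHermite_zero]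
    | succ n ih =>
      have hd (x : ℝ) : HasDerivAt (iteratedDeriv k h) (iteratedDeriv (k + 1) h x) x := by
        rw [iteratedDeriv_succ]
        exact (hs.differentiable_iteratedDeriv k
          (by exact_mod_cast WithTop.coe_lt_top _) x).hasDerivAt
      rw [← integral_deriv_mul_realHermite hd (hh _) (hh _), ih, add_right_comm, add_assoc]
  simpa using shift n 0

theorem iteratedDeriv_polynomial_eval (p : ℝ[X]) (n : ℕ) :
    iteratedDeriv n (fun x => p.eval x) = fun x => (derivative^[n] p).eval x := by
  induction n with
  | zero => simp
  | succ n ih =>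
    ext x
    rw [iteratedDeriv_succ, ih, Function.iterate_succ_apply', Polynomial.deriv]

theorem integral_polynomial_mul_realHermite {p : ℝ[X]} {n : ℕ} (hp : p.natDegree ≤ n) :
    ∫ x, p.eval x * (realHermite n).eval x ∂γ = n.factorial * p.coeff n := by
  have hconst : derivative^[n] p = C (n.factorial * p.coeff n) := by
    rw [eq_C_of_natDegree_le_zero ((natDegree_iterate_derivative p n).trans (by omega)),
      coeff_iterate_derivative]
    simp [Nat.descFactorial_self]
  have hs : ContDiff ℝ (⊤ : ℕ∞) fun x => p.eval x := p.contDiff_aeval _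
  rw [integral_mul_realHermite hs fun k => by
    simpa only [iteratedDeriv_polynomial_eval] using memLp_polynomial_eval_gaussianReal 0 1 _]
  simp [iteratedDeriv_polynomial_eval, hconst]

theorem integral_realHermite_mul_realHermite (m n : ℕ) :
    ∫ x, (realHermite m).eval x * (realHermite n).eval x ∂γ =
      if m = n then (n.factorial : ℝ) else 0 := by
  have natDegree_eq (k : ℕ) : (realHermite k).natDegree = k :=
    natDegree_eq_of_degree_eq_some (degree_realHermite k)
  have of_le {m n : ℕ} (hmn : m ≤ n) :
      ∫ x, (realHermite m).eval x * (realHermite n).eval x ∂γ =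
        if m = n then (n.factorial : ℝ) else 0 := by
    rw [integral_polynomial_mul_realHermite ((natDegree_eq m).trans_le hmn)]
    split_ifs with h
    · rw [h, coeff_realHermite_self, mul_one]
    · rw [coeff_eq_zero_of_natDegree_lt (by rw [natDegree_eq]; omega), mul_zero]
  rcases le_total m n with h | h
  · exact of_le h
  · simp_rw [mul_comm (eval _ (realHermite m)), of_le h, eq_comm (a := n)]
    split_ifs with h' <;> simp [h']

section Fourier

variable {Ω : Type*} [MeasurableSpace Ω] {μ : Measure Ω}

theorem integral_withDensity_ofReal_sub_integral_withDensity_ofReal_neg {F : Type*}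
    [NormedAddCommGroup F] [NormedSpace ℝ F] {G : Ω → ℝ} (hG : AEMeasurable G μ)
    {h : Ω → F} (hh : AEStronglyMeasurable h μ) (hGh : Integrable (fun ω => G ω • h ω) μ) :
    ∫ ω, h ω ∂μ.withDensity (fun ω => .ofReal (G ω)) -
      ∫ ω, h ω ∂μ.withDensity (fun ω => .ofReal (-G ω)) = ∫ ω, G ω • h ω ∂μ := by
  have integrable_max_smul {G : Ω → ℝ} (hG : AEMeasurable G μ)
      (hGh : Integrable (fun ω => G ω • h ω) μ) : Integrable (fun ω => max (G ω) 0 • h ω) μ := by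
    refine hGh.mono ((hG.max aemeasurable_const).aestronglyMeasurable.smul hh)
      (.of_forall fun ω => ?_)
    rw [norm_smul, norm_smul]
    gcongr
    exact abs_max_le_max_abs_abs.trans (by simp)
  have integral_eq {G : Ω → ℝ} (hG : AEMeasurable G μ) :
      ∫ ω, h ω ∂μ.withDensity (fun ω => .ofReal (G ω)) = ∫ ω, max (G ω) 0 • h ω ∂μ := by
    rw [integral_withDensity_eq_integral_toReal_smul₀ hG.ennreal_ofReal (by simp)]
    simp [ENNReal.toReal_ofReal']
  have hGh' : Integrable (fun ω => -G ω • h ω) μ := by simpa using hGh.neg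
  rw [integral_eq hG, integral_eq (G := fun ω => -G ω) hG.neg,
    ← integral_sub (integrable_max_smul hG hGh)
      (integrable_max_smul (G := fun ω => -G ω) hG.neg hGh')]
  simp only [← sub_smul, max_zero_sub_max_neg_zero_eq_self]

theorem integral_smul_exp_mul_I_eq_zero {G Y : Ω → ℝ} (hG : Integrable G μ)
    (hY : AEMeasurable Y μ) (hcos : ∫ ω, Real.cos (Y ω) * G ω ∂μ = 0)
    (hsin : ∫ ω, Real.sin (Y ω) * G ω ∂μ = 0) :
    ∫ ω, G ω • Complex.exp (Y ω * Complex.I) ∂μ = 0 := by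
  have hint : Integrable (fun ω => G ω • Complex.exp (Y ω * Complex.I)) μ :=
    hG.smul_bdd (C := 1) (by fun_prop)
      (.of_forall fun ω => (Complex.norm_exp_ofReal_mul_I _).le)
  rw [← integral_re_add_im hint]
  simp [Complex.exp_ofReal_mul_I_re, Complex.exp_ofReal_mul_I_im, mul_comm (G _), hcos, hsin]

variable {E : Type*} [NormedAddCommGroup E] [NormedSpace ℝ E] [MeasurableSpace E] [BorelSpace E]
  [SecondCountableTopology E] [CompleteSpace E]

theorem map_withDensity_ofReal_eq_of_integral_smul_exp_eq_zero {G : Ω → ℝ} (hG : Integrable G μ)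
    {X : Ω → E} (hX : Measurable X)
    (h : ∀ L : StrongDual ℝ E, ∫ ω, G ω • Complex.exp (L (X ω) * Complex.I) ∂μ = 0) :
    (μ.withDensity fun ω => .ofReal (G ω)).map X =
      (μ.withDensity fun ω => .ofReal (-G ω)).map X := by
  have := isFiniteMeasure_withDensity_ofReal hG.2
  have := isFiniteMeasure_withDensity_ofReal hG.neg.2
  refine Measure.ext_of_charFunDual (funext fun L => ?_)
  have hexp : AEStronglyMeasurable (fun ω => Complex.exp (L (X ω) * Complex.I)) μ :=
    (Measurable.aemeasurable (by fun_prop)).aestronglyMeasurable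
  simp only [charFunDual_apply]
  rw [integral_map hX.aemeasurable (by fun_prop), integral_map hX.aemeasurable (by fun_prop),
    ← sub_eq_zero, ← h L]
  exact integral_withDensity_ofReal_sub_integral_withDensity_ofReal_neg hG.aemeasurable hexp
    (hG.smul_bdd (C := 1) hexp (.of_forall fun ω => (Complex.norm_exp_ofReal_mul_I _).le))

theorem integral_smul_comp_eq_zero_of_integral_smul_exp_eq_zero {F : Type*}
    [NormedAddCommGroup F] [NormedSpace ℝ F] {G : Ω → ℝ} (hG : Integrable G μ) {X : Ω → E}
    (hX : Measurable X)
    (h : ∀ L : StrongDual ℝ E, ∫ ω, G ω • Complex.exp (L (X ω) * Complex.I) ∂μ = 0)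
    {f : E → F} (hf : StronglyMeasurable f) (hGf : Integrable (fun ω => G ω • f (X ω)) μ) :
    ∫ ω, G ω • f (X ω) ∂μ = 0 := by
  rw [← integral_withDensity_ofReal_sub_integral_withDensity_ofReal_neg
    (h := fun ω => f (X ω)) hG.aemeasurable (hf.comp_measurable hX).aestronglyMeasurable hGf,
    sub_eq_zero,
    ← integral_map hX.aemeasurable hf.aestronglyMeasurable,
    ← integral_map hX.aemeasurable hf.aestronglyMeasurable,
    map_withDensity_ofReal_eq_of_integral_smul_exp_eq_zero hG hX h]

theorem map_pi_withDensity_ofReal_eq_of_integral_smul_exp_eq_zero {ι : Type*} {G : Ω → ℝ}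
    (hG : Integrable G μ) {X : ι → Ω → ℝ} (hX : ∀ i, Measurable (X i))
    (h : ∀ (I : Finset ι) (L : StrongDual ℝ (I → ℝ)),
      ∫ ω, G ω • Complex.exp (L (fun i => X i ω) * Complex.I) ∂μ = 0) :
    (μ.withDensity fun ω => .ofReal (G ω)).map (fun ω i => X i ω) =
      (μ.withDensity fun ω => .ofReal (-G ω)).map fun ω i => X i ω := by
  have := isFiniteMeasure_withDensity_ofReal hG.2
  have hX' : Measurable fun ω i => X i ω := measurable_pi_lambda _ hX
  have hlim (ν : Measure Ω) : IsProjectiveLimit (ν.map fun ω i => X i ω)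
      fun I : Finset ι => ν.map fun ω (i : I) => X i ω := fun I => by
    rw [Measure.map_map (Finset.measurable_restrict I) hX']
    rfl
  refine (hlim _).unique ?_
  convert hlim (μ.withDensity fun ω => .ofReal (-G ω)) using 2 with I
  exact map_withDensity_ofReal_eq_of_integral_smul_exp_eq_zero hG (by fun_prop) (h I)

theorem ae_eq_zero_of_integral_smul_exp_eq_zero {ι : Type*} {G : Ω → ℝ}
    (hG : Integrable G μ) {X : ι → Ω → ℝ} (hX : ∀ i, Measurable (X i))
    (hGX : AEStronglyMeasurable[⨆ i, MeasurableSpace.comap (X i) inferInstance] G μ)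
    (h : ∀ (I : Finset ι) (L : StrongDual ℝ (I → ℝ)),
      ∫ ω, G ω • Complex.exp (L (fun i => X i ω) * Complex.I) ∂μ = 0) :
    G =ᵐ[μ] 0 := by
  have hX' : Measurable fun ω i => X i ω := measurable_pi_lambda _ hX
  have hcomap : (⨆ i, MeasurableSpace.comap (X i) inferInstance) =
      MeasurableSpace.comap (fun ω i => X i ω) MeasurableSpace.pi := by
    simp only [MeasurableSpace.pi, MeasurableSpace.comap_iSup, MeasurableSpace.comap_comp]
    rfl
  rw [hcomap] at hGX
  have hle := hX'.comap_le
  have setIntegral_eq_zero (A : Set (ι → ℝ)) (hA : MeasurableSet A) :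
      ∫ ω in (fun ω i => X i ω) ⁻¹' A, G ω ∂μ = 0 := by
    rw [integral_eq_lintegral_pos_part_sub_lintegral_neg_part hG.integrableOn,
      ← withDensity_apply _ (hX' hA), ← withDensity_apply _ (hX' hA),
      ← Measure.map_apply hX' hA, ← Measure.map_apply hX' hA,
      map_pi_withDensity_ofReal_eq_of_integral_smul_exp_eq_zero hG hX h, sub_self]
  have hmk : hGX.mk G =ᵐ[μ.trim hle] 0 := by
    refine ((hG.congr hGX.ae_eq_mk).trim hle
      hGX.stronglyMeasurable_mk).ae_eq_zero_of_forall_setIntegral_eq_zero ?_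
    rintro _ ⟨A, hA, rfl⟩ -
    rw [← setIntegral_trim hle hGX.stronglyMeasurable_mk ⟨A, hA, rfl⟩,
      ← setIntegral_eq_zero A hA]
    exact setIntegral_congr_ae (hX' hA) (hGX.ae_eq_mk.mono fun ω hω _ => hω.symm)
  exact hGX.ae_eq_mk.trans (ae_eq_of_ae_eq_trim hmk)

end Fourier

theorem eq_zero_of_integral_smul_exp_gaussianReal_eq_zero {f : Lp ℝ 2 γ}
    (h : ∀ c : ℝ, ∫ x, f x • Complex.exp (↑(c * x) * Complex.I) ∂γ = 0) : f = 0 := by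
  rw [Lp.eq_zero_iff_ae_eq_zero]
  refine ae_eq_zero_of_integral_smul_exp_eq_zero (X := fun _ : Unit => id)
    ((Lp.memLp f).integrable one_le_two) (fun _ => measurable_id) ?_ fun I L => ?_
  · rw [iSup_const, MeasurableSpace.comap_id]
    exact Lp.aestronglyMeasurable f
  · have hL (x : ℝ) : L (fun _ => x) = L 1 * x := by
      rw [mul_comm, ← smul_eq_mul, ← map_smul]
      congr 1
      ext
      simp
    simpa only [hL, id_eq] using h (L 1)

theorem integrable_mul_exp_abs_gaussianReal (f : Lp ℝ 2 γ) (c : ℝ) :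
    Integrable (fun x => f x * Real.exp |c * x|) γ := by
  have hexp : MemLp (fun x => Real.exp |c * x|) 2 γ := by
    rw [memLp_two_iff_integrable_sq (by fun_prop)]
    have hsq (x : ℝ) : Real.exp |c * x| ^ 2 = Real.exp (|2 * c| * |x|) := by
      rw [← Real.exp_nat_mul, abs_mul, abs_mul, abs_two]
      push_cast
      ring_nf
    simp_rw [hsq]
    exact integrable_exp_abs_mul_abs (X := fun x : ℝ => x) (integrable_exp_mul_gaussianReal _)
      (integrable_exp_mul_gaussianReal _)
  exact (Lp.memLp f).integrable_mul hexp

/- Expand the exponential: its series is dominated by `exp |c * x|`, which lies in `L²(γ)`. -/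
theorem integral_smul_exp_gaussianReal_eq_zero {f : Lp ℝ 2 γ}
    (h : ∀ p : ℝ[X], ∫ x, f x * p.eval x ∂γ = 0) (c : ℝ) :
    ∫ x, f x • Complex.exp (↑(c * x) * Complex.I) ∂γ = 0 := by
  have term_eq (n : ℕ) (x : ℝ) : f x • (((c * x : ℝ) * Complex.I) ^ n / n.factorial) =
      ((f x * x ^ n : ℝ) : ℂ) * ((c * Complex.I) ^ n / n.factorial) := by
    push_cast
    rw [Complex.real_smul]
    ring
  have norm_term (n : ℕ) (x : ℝ) : ‖f x • (((c * x : ℝ) * Complex.I) ^ n / n.factorial)‖ =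
      |f x| * (|c * x| ^ n / n.factorial) := by
    simp
  have hsum (y : ℝ) : HasSum (fun n : ℕ => y ^ n / n.factorial) (Real.exp y) := by
    simpa [Real.exp_eq_exp_ℝ] using NormedSpace.expSeries_div_hasSum_exp y
  have hseries := hasSum_integral_of_dominated_convergence
    (F := fun (n : ℕ) x => f x • (((c * x : ℝ) * Complex.I) ^ n / n.factorial))
    (f := fun x => f x • Complex.exp (↑(c * x) * Complex.I)) (μ := γ)
    (fun n x => |f x| * (|c * x| ^ n / n.factorial))
    (fun n => (Lp.aestronglyMeasurable f).smul (Continuous.aestronglyMeasurable (by fun_prop)))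
    (fun n => .of_forall fun x => (norm_term n x).le)
    (.of_forall fun x => ((hsum _).mul_left _).summable)
    (by
      simp_rw [((hsum _).mul_left _).tsum_eq]
      simpa [abs_mul] using (integrable_mul_exp_abs_gaussianReal f c).abs)
    (.of_forall fun x => by
      simpa [Complex.exp_eq_exp_ℂ] using
        (NormedSpace.expSeries_div_hasSum_exp ((c * x : ℝ) * Complex.I)).const_smul (f x))
  refine hseries.unique ?_
  convert hasSum_zero with n
  have hpow : ∫ x, f x * x ^ n ∂γ = 0 := by simpa using h (X ^ n)
  simp_rw [term_eq]
  rw [integral_mul_const, integral_complex_ofReal, hpow]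
  simp

/-- The Hermite polynomial `Heₙ` as an element of `L²` of the standard Gaussian measure. -/
noncomputable def hermiteLp (n : ℕ) : Lp ℝ 2 γ :=
  (memLp_polynomial_eval_gaussianReal 0 1 (realHermite n)).toLp _

theorem coeFn_hermiteLp (n : ℕ) : hermiteLp n =ᵐ[γ] fun x => (realHermite n).eval x :=
  MemLp.coeFn_toLp _

theorem inner_hermiteLp_right (f : Lp ℝ 2 γ) (n : ℕ) :
    inner ℝ f (hermiteLp n) = ∫ x, f x * (realHermite n).eval x ∂γ := by
  rw [L2.inner_def]
  refine integral_congr_ae ?_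
  filter_upwards [coeFn_hermiteLp n] with x hx
  simp [hx, mul_comm]

theorem inner_hermiteLp_hermiteLp (m n : ℕ) :
    inner ℝ (hermiteLp m) (hermiteLp n) = if m = n then (n.factorial : ℝ) else 0 := by
  rw [inner_hermiteLp_right, ← integral_realHermite_mul_realHermite]
  exact integral_congr_ae <| by filter_upwards [coeFn_hermiteLp m] with x hx; rw [hx]

theorem eq_zero_of_forall_inner_hermiteLp_eq_zero {f : Lp ℝ 2 γ}
    (h : ∀ n, inner ℝ f (hermiteLp n) = 0) : f = 0 := by
  refine eq_zero_of_integral_smul_exp_gaussianReal_eq_zero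
    (integral_smul_exp_gaussianReal_eq_zero fun p => ?_)
  have integrable_mul (q : ℝ[X]) : Integrable (fun x => f x * q.eval x) γ :=
    (Lp.memLp f).integrable_mul (memLp_polynomial_eval_gaussianReal 0 1 q)
  have hp : p ∈ Submodule.span ℝ (Set.range realHermite) := by simp [span_range_realHermite]
  induction hp using Submodule.span_induction with
  | mem _ hq =>
    obtain ⟨n, rfl⟩ := hq
    rw [← inner_hermiteLp_right, h]
  | zero => simp
  | add q r _ _ hq hr =>
    simp only [eval_add, mul_add]
    rw [integral_add (integrable_mul q) (integrable_mul r), hq, hr, add_zero]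
  | smul a q _ hq =>
    simp only [eval_smul, smul_eq_mul, mul_left_comm _ a]
    rw [integral_const_mul, hq, mul_zero]

/-- The orthonormal basis of `L²` of the standard Gaussian measure formed by the normalised
Hermite polynomials `Heₙ / √n!`. -/
noncomputable def hermiteBasis : HilbertBasis ℕ ℝ (Lp ℝ 2 γ) :=
  HilbertBasis.mkOfOrthogonalEqBot (v := fun n => (√(n.factorial : ℝ))⁻¹ • hermiteLp n)
    (by
      rw [orthonormal_iff_ite]
      intro m n
      rw [real_inner_smul_left, real_inner_smul_right, inner_hermiteLp_hermiteLp]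
      split_ifs with h
      · subst h
        field_simp
        rw [Real.sq_sqrt (by positivity)]
      · simp)
    (by
      rw [Submodule.eq_bot_iff]
      refine fun f hf => eq_zero_of_forall_inner_hermiteLp_eq_zero fun n => ?_
      have hn := (Submodule.mem_orthogonal' _ f).1 hf _ (Submodule.subset_span ⟨n, rfl⟩)
      rw [real_inner_smul_right] at hn
      exact (mul_eq_zero.1 hn).resolve_left (by positivity))

theorem hasSum_inner_hermiteLp_smul (f : Lp ℝ 2 γ) :
    HasSum (fun n => (inner ℝ f (hermiteLp n) / n.factorial) • hermiteLp n) f := by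
  convert hermiteBasis.hasSum_repr f using 2 with n
  rw [hermiteBasis.repr_apply_apply, hermiteBasis, HilbertBasis.coe_mkOfOrthogonalEqBot,
    real_inner_smul_left, smul_smul, real_inner_comm]
  congr 1
  field_simp
  rw [Real.sq_sqrt (by positivity)]

theorem measurable_sign : Measurable Real.sign :=
  .ite measurableSet_Iio measurable_const (.ite measurableSet_Ioi measurable_const measurable_const)

theorem abs_sign_le_one (x : ℝ) : |x.sign| ≤ 1 := by
  rcases x.sign_apply_eq with h | h | h <;> simp [h]

theorem memLp_sign_comp {Ω : Type*} [MeasurableSpace Ω] {μ : Measure Ω} [IsFiniteMeasure μ]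
    {X : Ω → ℝ} (hX : AEMeasurable X μ) (p : ℝ≥0∞) : MemLp (fun ω => (X ω).sign) p μ :=
  .of_bound (measurable_sign.comp_aemeasurable hX).aestronglyMeasurable 1
    (.of_forall fun _ => abs_sign_le_one _)

/-- The random variable `sign X`, as an element of `L²(μ)`. -/
noncomputable def signLp {Ω : Type*} [MeasurableSpace Ω] {μ : Measure Ω} [IsFiniteMeasure μ]
    {X : Ω → ℝ} (hX : AEMeasurable X μ) : Lp ℝ 2 μ :=
  (memLp_sign_comp hX 2).toLp _

theorem integral_sign_gaussianReal : ∫ x, x.sign ∂γ = 0 := by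
  have hmap : (γ).map Neg.neg = γ := by simpa using gaussianReal_map_neg (μ := 0) (v := 1)
  have hneg : ∫ x, x.sign ∂γ = ∫ x, (-x).sign ∂γ := by
    conv_lhs => rw [← hmap]
    exact integral_map_equiv (MeasurableEquiv.neg ℝ) _
  simp only [Real.sign_neg, integral_neg] at hneg
  linarith

theorem setIntegral_Ioi_realHermite_succ (n : ℕ) :
    ∫ x in Set.Ioi 0, (realHermite (n + 1)).eval x ∂γ =
      (realHermite n).eval 0 / √(2 * Real.pi) := by
  have integrable (k : ℕ) : Integrable fun x => (realHermite k).eval x * gaussianPDFReal 0 1 x :=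
    integrable_gaussianReal_iff.1 (integrable_polynomial_eval_gaussianReal 0 1 _)
  have hderiv := hasDerivAt_realHermite_mul_gaussianPDFReal n
  have ftc := integral_Ioi_of_hasDerivAt_of_tendsto' (a := 0) (fun x _ => hderiv x)
    (integrable (n + 1)).neg.integrableOn
    (tendsto_zero_of_hasDerivAt_of_integrableOn_Ioi (a := 0) (fun x _ => hderiv x)
      (integrable (n + 1)).neg.integrableOn (integrable n).integrableOn)
  rw [integral_neg, zero_sub, neg_inj] at ftc
  rw [← integral_indicator measurableSet_Ioi, integral_gaussianReal_eq_integral_smul one_ne_zero]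
  simp only [smul_eq_mul, ← Set.indicator_mul_right]
  rw [integral_indicator measurableSet_Ioi]
  simp_rw [mul_comm (gaussianPDFReal _ _ _)]
  rw [ftc]
  simp [gaussianPDFReal_def, div_eq_mul_inv]

theorem integral_sign_mul_realHermite_succ (n : ℕ) :
    ∫ x, x.sign * (realHermite (n + 1)).eval x ∂γ =
      2 * (realHermite n).eval 0 / √(2 * Real.pi) := by
  have := nullSingletonClass_gaussianReal (μ := 0) (v := 1) one_ne_zero
  have hint := integrable_polynomial_eval_gaussianReal 0 1 (realHermite (n + 1))
  have hmean : ∫ x, (realHermite (n + 1)).eval x ∂γ = 0 := by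
    simpa [realHermite_zero] using integral_realHermite_mul_realHermite 0 (n + 1)
  have sign_mul_eq : ∀ᵐ x ∂γ, x.sign * (realHermite (n + 1)).eval x =
      2 * (Set.Ioi 0).indicator (fun y => (realHermite (n + 1)).eval y) x -
        (realHermite (n + 1)).eval x := by
    filter_upwards [Measure.ae_ne γ 0] with x hx
    rcases hx.lt_or_gt with h | h
    · simp [Real.sign_of_neg h, h.le]
    · simp [Real.sign_of_pos h, h, two_mul]
  rw [integral_congr_ae sign_mul_eq, integral_sub ((hint.indicator measurableSet_Ioi).const_mul 2)
    hint, integral_const_mul, integral_indicator measurableSet_Ioi,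
    setIntegral_Ioi_realHermite_succ, hmean, sub_zero, mul_div_assoc]

theorem integral_sign_mul_realHermite_of_even {n : ℕ} (hn : Even n) :
    ∫ x, x.sign * (realHermite n).eval x ∂γ = 0 := by
  cases n with
  | zero => simpa [realHermite_zero] using integral_sign_gaussianReal
  | succ n =>
    rw [integral_sign_mul_realHermite_succ,
      eval_zero_realHermite_of_odd (by simpa [Nat.even_add_one] using hn)]
    simp

/-- The coefficient of `He₂ₖ₊₁` in the Hermite expansion of `sign` in `L²` of the standard Gaussian
measure. -/
noncomputable def signCoeff (k : ℕ) : ℝ :=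
  2 * (-1) ^ k / ((2 * k + 1) * √(2 * Real.pi) * k.factorial * 2 ^ k)

theorem factorial_two_mul_eq (k : ℕ) :
    (2 * k).factorial = 2 ^ k * k.factorial * (2 * k - 1).doubleFactorial := by
  cases k with
  | zero => simp
  | succ k =>
    rw [← Nat.doubleFactorial_two_mul]
    exact Nat.factorial_eq_mul_doubleFactorial (2 * k + 1)

theorem integral_sign_mul_realHermite_two_mul_add_one (k : ℕ) :
    ∫ x, x.sign * (realHermite (2 * k + 1)).eval x ∂γ = signCoeff k * (2 * k + 1).factorial := by
  have : (0 : ℝ) < √(2 * Real.pi) := by positivity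
  rw [integral_sign_mul_realHermite_succ, eval_zero_realHermite_two_mul, signCoeff,
    Nat.factorial_succ, factorial_two_mul_eq]
  push_cast
  field_simp

theorem inner_signLp_hermiteLp (n : ℕ) :
    inner ℝ (signLp (μ := γ) aemeasurable_id) (hermiteLp n) =
      ∫ x, x.sign * (realHermite n).eval x ∂γ := by
  rw [inner_hermiteLp_right]
  refine integral_congr_ae ?_
  filter_upwards [(memLp_sign_comp (μ := γ) aemeasurable_id 2).coeFn_toLp] with x hx
  rw [signLp, hx, id]

theorem hasSum_signCoeff_smul_hermiteLp :
    HasSum (fun k => signCoeff k • hermiteLp (2 * k + 1)) (signLp (μ := γ) aemeasurable_id) := by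
  have hinj : Function.Injective fun k : ℕ => 2 * k + 1 := fun _ _ _ => by simp_all
  convert (hinj.hasSum_iff fun n hn => ?_).2 (hasSum_inner_hermiteLp_smul _) using 2 with k
  · rw [Function.comp_apply, inner_signLp_hermiteLp, integral_sign_mul_realHermite_two_mul_add_one,
      mul_div_cancel_right₀ _ (by positivity)]
  · have hn : Even n := by
      rw [← Nat.not_odd_iff_even]
      rintro ⟨k, rfl⟩
      exact hn ⟨k, rfl⟩
    rw [inner_signLp_hermiteLp, integral_sign_mul_realHermite_of_even hn, zero_div, zero_smul]

section GaussianSpace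

variable {Ω : Type*} [MeasurableSpace Ω] {P : Measure Ω}

theorem coeFn_sum_dual_smul {ι : Type*} [Fintype ι] [DecidableEq ι] (X : ι → Lp ℝ 2 P)
    (L : StrongDual ℝ (ι → ℝ)) :
    ↑(∑ i, L (Pi.single i 1) • X i : Lp ℝ 2 P) =ᵐ[P] fun ω => L fun i => X i ω := by
  have hsmul : ∀ᵐ ω ∂P, ∀ i, (L (Pi.single i 1) • X i : Lp ℝ 2 P) ω = L (Pi.single i 1) * X i ω :=
    ae_all_iff.2 fun i => Lp.coeFn_smul _ _
  filter_upwards [Lp.coeFn_finsetSum Finset.univ fun i => L (Pi.single i 1) • X i, hsmul]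
    with ω hsum hω
  rw [hsum, Finset.sum_apply, ← LinearMap.sum_single_apply (fun _ => ℝ) fun i => X i ω, map_sum]
  refine Finset.sum_congr rfl fun i _ => ?_
  rw [hω, mul_comm, ← smul_eq_mul, ← map_smul, ← Pi.single_smul, smul_eq_mul, mul_one]

theorem isGaussianProcess_coeFn (V : Submodule ℝ (Lp ℝ 2 P))
    (hV : ∀ X ∈ V, HasGaussianLaw X P) : IsGaussianProcess (fun (X : V) => ⇑(X : Lp ℝ 2 P)) P := by
  classical
  refine ⟨fun I => ⟨⟨fun L => ?_⟩⟩⟩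
  have hmeas : AEMeasurable (fun ω => I.restrict fun X : V => (X : Lp ℝ 2 P) ω) P :=
    aemeasurable_pi_lambda _ fun X => (Lp.stronglyMeasurable _).measurable.aemeasurable
  have hL : HasGaussianLaw (L ∘ fun ω => I.restrict fun X : V => (X : Lp ℝ 2 P) ω) P :=
    (hV _ (V.sum_mem fun X _ => V.smul_mem _ X.1.2)).congr
      (coeFn_sum_dual_smul (fun X : I => (X : Lp ℝ 2 P)) L)
  have hmap := hL.map_eq_gaussianReal
  rw [AEMeasurable.map_map_of_aemeasurable (by fun_prop) hmeas, hmap,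
    variance_map (by fun_prop) hmeas, integral_map hmeas (by fun_prop)]
  rfl

theorem norm_sq_eq_integral (X : Lp ℝ 2 P) : ‖X‖ ^ 2 = ∫ ω, X ω ^ 2 ∂P := by
  rw [← real_inner_self_eq_norm_sq, L2.inner_def]
  simp [pow_two]

theorem continuous_charFun_map [IsProbabilityMeasure P] (t : ℝ) :
    Continuous fun X : Lp ℝ 2 P => charFun (P.map X) t := by
  refine continuous_iff_seqContinuous.2 fun X Y hXY => ?_
  have hdist := (tendstoInMeasure_of_tendsto_Lp hXY).tendstoInDistribution fun n =>
    (Lp.stronglyMeasurable (X n)).measurable.aemeasurable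
  exact ProbabilityMeasure.tendsto_iff_tendsto_charFun.1 hdist.tendsto t

theorem isClosed_setOf_map_eq_gaussianReal [IsProbabilityMeasure P] :
    IsClosed {X : Lp ℝ 2 P | P.map X = gaussianReal 0 (‖X‖₊ ^ 2)} := by
  have heq : {X : Lp ℝ 2 P | P.map X = gaussianReal 0 (‖X‖₊ ^ 2)} =
      ⋂ t : ℝ, {X : Lp ℝ 2 P | charFun (P.map X) t = Complex.exp (-(‖X‖ ^ 2 * t ^ 2 / 2))} := by
    ext X
    have := Measure.isProbabilityMeasure_map (μ := P)
      (Lp.stronglyMeasurable X).measurable.aemeasurable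
    have hγ (t : ℝ) : charFun (gaussianReal 0 (‖X‖₊ ^ 2)) t =
        Complex.exp (-(‖X‖ ^ 2 * t ^ 2 / 2)) := by simp [charFun_gaussianReal]
    simp only [Set.mem_iInter, Set.mem_ofPred_eq, ← hγ]
    exact ⟨fun h t => by rw [h], fun h => Measure.ext_of_charFun (funext h)⟩
  rw [heq]
  exact isClosed_iInter fun t => isClosed_eq (continuous_charFun_map t) (by fun_prop)

variable {B : ℝ≥0 → Ω → ℝ} {T : ℝ≥0}

theorem exists_ae_eq_finsuppSum_of_mem_span {X : Lp ℝ 2 P}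
    (hX : X ∈ Submodule.span ℝ {X : Lp ℝ 2 P | ∃ s ≤ T, X =ᵐ[P] B s}) :
    ∃ c : ℝ≥0 →₀ ℝ, X =ᵐ[P] fun ω => c.sum fun s a => a * B s ω := by
  induction hX using Submodule.span_induction with
  | mem X hX =>
    obtain ⟨s, -, hXs⟩ := hX
    exact ⟨Finsupp.single s 1, by simpa using hXs⟩
  | zero => exact ⟨0, Lp.coeFn_zero ℝ 2 P⟩
  | add X Y _ _ hX hY =>
    obtain ⟨c, hc⟩ := hX
    obtain ⟨d, hd⟩ := hY
    refine ⟨c + d, ?_⟩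
    filter_upwards [hc, hd, Lp.coeFn_add X Y] with ω hcω hdω hω
    rw [hω, Pi.add_apply, hcω, hdω, Finsupp.sum_add_index' (by simp) (by simp [add_mul])]
  | smul a X _ hX =>
    obtain ⟨c, hc⟩ := hX
    refine ⟨a • c, ?_⟩
    filter_upwards [hc, Lp.coeFn_smul a X] with ω hcω hω
    rw [hω, Pi.smul_apply, hcω, Finsupp.sum_smul_index (by simp), Finsupp.smul_sum]
    simp [mul_assoc]

theorem map_eq_gaussianReal_of_mem_span (hB : IsGaussianProcess B P)
    (hB0 : ∀ t, ∫ ω, B t ω ∂P = 0) {X : Lp ℝ 2 P}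
    (hX : X ∈ Submodule.span ℝ {X : Lp ℝ 2 P | ∃ s ≤ T, X =ᵐ[P] B s}) :
    P.map X = gaussianReal 0 (‖X‖₊ ^ 2) := by
  obtain ⟨c, hc⟩ := exists_ae_eq_finsuppSum_of_mem_span hX
  have hgauss : HasGaussianLaw X P :=
    ((hB.smul c).hasGaussianLaw_fun_sum (I := c.support)).congr hc.symm
  have hmean : ∫ ω, X ω ∂P = 0 := by
    rw [integral_congr_ae hc]
    simp only [Finsupp.sum]
    rw [integral_finsetSum _ fun s _ => (hB.hasGaussianLaw_eval s).integrable.const_mul _]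
    simp [integral_const_mul, hB0]
  rw [hgauss.map_eq_gaussianReal, hmean, variance_of_integral_eq_zero hgauss.aemeasurable hmean,
    ← norm_sq_eq_integral]
  congr
  ext
  simp

theorem map_eq_gaussianReal_of_mem_hilb (hB : IsGaussianProcess B P)
    (hB0 : ∀ t, ∫ ω, B t ω ∂P = 0) {X : Lp ℝ 2 P} (hX : X ∈ hilb B P T) :
    P.map X = gaussianReal 0 (‖X‖₊ ^ 2) := by
  have := hB.isProbabilityMeasure
  exact closure_minimal (fun _ => map_eq_gaussianReal_of_mem_span hB hB0)
    isClosed_setOf_map_eq_gaussianReal hX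

theorem hasGaussianLaw_of_mem_hilb (hB : IsGaussianProcess B P)
    (hB0 : ∀ t, ∫ ω, B t ω ∂P = 0) {X : Lp ℝ 2 P} (hX : X ∈ hilb B P T) :
    HasGaussianLaw X P :=
  ⟨by rw [map_eq_gaussianReal_of_mem_hilb hB hB0 hX]; infer_instance⟩

theorem integral_eq_zero_of_mem_hilb (hB : IsGaussianProcess B P)
    (hB0 : ∀ t, ∫ ω, B t ω ∂P = 0) {X : Lp ℝ 2 P} (hX : X ∈ hilb B P T) :
    ∫ ω, X ω ∂P = 0 := by
  have h := integral_map (μ := P) (Lp.stronglyMeasurable X).measurable.aemeasurable (f := id)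
    (by fun_prop)
  simpa [map_eq_gaussianReal_of_mem_hilb hB hB0 hX] using h.symm

theorem measurePreserving_of_norm_eq_one (hB : IsGaussianProcess B P)
    (hB0 : ∀ t, ∫ ω, B t ω ∂P = 0) {u : hilb B P T} (hu : ‖u‖ = 1) :
    MeasurePreserving (u : Lp ℝ 2 P) P (gaussianReal 0 1) where
  measurable := (Lp.stronglyMeasurable _).measurable
  map_eq := by
    have hu' : ‖(u : Lp ℝ 2 P)‖₊ = 1 := NNReal.eq hu
    rw [map_eq_gaussianReal_of_mem_hilb hB hB0 u.2, hu', one_pow]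

theorem indepFun_of_inner_eq_zero (hB : IsGaussianProcess B P) (hB0 : ∀ t, ∫ ω, B t ω ∂P = 0)
    {ι : Type*} (φ : ι → hilb B P T) (u : hilb B P T) (h : ∀ i, inner ℝ (φ i) u = 0) :
    IndepFun (fun ω i => (φ i : Lp ℝ 2 P) ω) (u : Lp ℝ 2 P) P := by
  have := hB.isProbabilityMeasure
  have hproc := (isGaussianProcess_coeFn (hilb B P T) fun _ =>
    hasGaussianLaw_of_mem_hilb hB hB0).comp_right (Sum.elim φ fun _ : Unit => u)
  have hcov (i : ι) : cov[(φ i : Lp ℝ 2 P), (u : Lp ℝ 2 P); P] = 0 := by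
    rw [covariance_eq_sub (Lp.memLp _) (Lp.memLp _), integral_eq_zero_of_mem_hilb hB hB0 u.2,
      mul_zero, sub_zero, ← h i, Submodule.coe_inner, L2.inner_def]
    simp [mul_comm]
  rw [Sum.comp_elim] at hproc
  exact (hproc.indepFun_of_covariance_eq_zero
    (fun i => (Lp.stronglyMeasurable (φ i : Lp ℝ 2 P)).measurable.aemeasurable)
    (fun _ => (Lp.stronglyMeasurable (u : Lp ℝ 2 P)).measurable.aemeasurable)
    fun i _ => hcov i).comp measurable_id (measurable_pi_apply ())

end GaussianSpace

theorem integral_comp_prodMk_of_indepFun {E Ω : Type*} [MeasurableSpace E]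
    [MeasurableSpace Ω] {P : Measure Ω} [IsFiniteMeasure P]
    {Z : Ω → E} {U : Ω → ℝ} (hZ : AEMeasurable Z P)
    (hU : MeasurePreserving U P γ) (hZU : IndepFun Z U P)
    {h : E × ℝ → ℝ} (hh : Integrable h ((P.map Z).prod γ)) :
    ∫ ω, h (Z ω, U ω) ∂P = ∫ z, ∫ y, h (z, y) ∂γ ∂P.map Z := by
  have hlaw : P.map (fun ω => (Z ω, U ω)) = (P.map Z).prod γ := by
    rw [(indepFun_iff_map_prod_eq_prod_map_map hZ hU.aemeasurable).1 hZU, hU.map_eq]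
  rw [← integral_prod h hh, ← hlaw, integral_map (hZ.prodMk hU.aemeasurable)]
  rw [hlaw]
  exact hh.aestronglyMeasurable

section IntegrationByParts

variable {E : Type*} [NormedAddCommGroup E] [NormedSpace ℝ E]

theorem iteratedDeriv_comp_add_smul {f : E → ℝ} {k : ℕ} (hf : ContDiff ℝ k f) (z w : E) (y : ℝ) :
    iteratedDeriv k (fun y : ℝ => f (z + y • w)) y =
      iteratedFDeriv ℝ k f (z + y • w) fun _ => w := by
  let L : ℝ →L[ℝ] E := .toSpanSingleton ℝ w
  have hshift : ContDiff ℝ k fun x => f (z + x) := hf.comp (by fun_prop)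
  have h := L.iteratedFDeriv_comp_right hshift y le_rfl
  rw [iteratedFDeriv_comp_add_left] at h
  rw [iteratedDeriv]
  simpa [L] using! congrArg (fun A => A fun _ => (1 : ℝ)) h

theorem abs_iteratedFDeriv_apply_le {f : E → ℝ} {k : ℕ} {C : ℝ}
    (hC : ∀ x, ‖iteratedFDeriv ℝ k f x‖ ≤ C) (x w : E) :
    |iteratedFDeriv ℝ k f x fun _ => w| ≤ C * ‖w‖ ^ k :=
  ((iteratedFDeriv ℝ k f x).le_opNorm fun _ => w).trans <| by
    simpa using mul_le_mul_of_nonneg_right (hC x) (by positivity)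

theorem integral_comp_add_smul_mul_realHermite {f : E → ℝ} (hf : ContDiff ℝ (⊤ : ℕ∞) f)
    (hbdd : ∀ k, ∃ C, ∀ x, ‖iteratedFDeriv ℝ k f x‖ ≤ C) (n : ℕ) (z w : E) :
    ∫ y, f (z + y • w) * (realHermite n).eval y ∂γ =
      ∫ y, iteratedFDeriv ℝ n f (z + y • w) (fun _ => w) ∂γ := by
  have hline : ContDiff ℝ (⊤ : ℕ∞) fun y : ℝ => f (z + y • w) := hf.comp (by fun_prop)
  have hderiv (k : ℕ) := iteratedDeriv_comp_add_smul (hf.of_le (m := k) (mod_cast le_top)) z w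
  rw [integral_mul_realHermite hline fun k => ?_]
  · simp only [hderiv]
  · obtain ⟨C, hC⟩ := hbdd k
    refine .of_bound (hline.continuous_iteratedDeriv k (mod_cast le_top)).aestronglyMeasurable
      (C * ‖w‖ ^ k) (.of_forall fun y => ?_)
    rw [hderiv]
    exact abs_iteratedFDeriv_apply_le hC _ _

theorem integral_mul_realHermite_of_indepFun [MeasurableSpace E] [BorelSpace E]
    [SecondCountableTopology E] {Ω : Type*} [MeasurableSpace Ω] {P : Measure Ω} [IsFiniteMeasure P]
    {Z : Ω → E} {U : Ω → ℝ} (hZ : AEMeasurable Z P)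
    (hU : MeasurePreserving U P γ) (hZU : IndepFun Z U P) {f : E → ℝ}
    (hf : ContDiff ℝ (⊤ : ℕ∞) f) (hbdd : ∀ k, ∃ C, ∀ x, ‖iteratedFDeriv ℝ k f x‖ ≤ C) (n : ℕ)
    (w : E) :
    ∫ ω, f (Z ω + U ω • w) * (realHermite n).eval (U ω) ∂P =
      ∫ ω, iteratedFDeriv ℝ n f (Z ω + U ω • w) (fun _ => w) ∂P := by
  have hcont : Continuous fun p : E × ℝ => f (p.1 + p.2 • w) := hf.continuous.comp (by fun_prop)
  have hcontD : Continuous fun p : E × ℝ => iteratedFDeriv ℝ n f (p.1 + p.2 • w) fun _ => w :=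
    (ContinuousMultilinearMap.apply ℝ (fun _ : Fin n => E) ℝ fun _ => w).continuous.comp
      ((hf.continuous_iteratedFDeriv (m := n) (mod_cast le_top)).comp (by fun_prop))
  have hint : Integrable (fun p : E × ℝ => f (p.1 + p.2 • w) * (realHermite n).eval p.2)
      ((P.map Z).prod γ) := by
    obtain ⟨C, hC⟩ := hbdd 0
    exact ((integrable_polynomial_eval_gaussianReal 0 1 _).comp_snd _).bdd_mul
      hcont.aestronglyMeasurable (.of_forall fun p => by simpa using hC (p.1 + p.2 • w))
  have hintD : Integrable (fun p : E × ℝ => iteratedFDeriv ℝ n f (p.1 + p.2 • w) fun _ => w)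
      ((P.map Z).prod γ) := by
    obtain ⟨C, hC⟩ := hbdd n
    exact .of_bound hcontD.aestronglyMeasurable (C * ‖w‖ ^ n)
      (.of_forall fun p => abs_iteratedFDeriv_apply_le hC _ _)
  rw [integral_comp_prodMk_of_indepFun hZ hU hZU hint,
    integral_comp_prodMk_of_indepFun hZ hU hZU hintD]
  simp only [integral_comp_add_smul_mul_realHermite hf hbdd]

end IntegrationByParts

section Cylinders

variable {Ω : Type*} [MeasurableSpace Ω] {P : Measure Ω} {B : ℝ≥0 → Ω → ℝ} {T : ℝ≥0}

theorem iteratedFDeriv_comp_dual_apply {E : Type*} [NormedAddCommGroup E] [NormedSpace ℝ E]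
    {h : ℝ → ℝ} {k : ℕ} (hs : ContDiff ℝ k h) (L : StrongDual ℝ E) (x : E) (y : Fin k → E) :
    iteratedFDeriv ℝ k (h ∘ L) x y = (∏ i, L (y i)) * iteratedDeriv k h (L x) := by
  rw [L.iteratedFDeriv_comp_right hs x le_rfl,
    ContinuousMultilinearMap.compContinuousLinearMap_apply,
    iteratedFDeriv_apply_eq_iteratedDeriv_mul_prod, smul_eq_mul]

theorem norm_iteratedFDeriv_comp_dual_le {E : Type*} [NormedAddCommGroup E] [NormedSpace ℝ E]
    {h : ℝ → ℝ} {k : ℕ} (hs : ContDiff ℝ k h) {C : ℝ} (hC : ∀ x, |iteratedDeriv k h x| ≤ C)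
    (L : StrongDual ℝ E) (x : E) :
    ‖iteratedFDeriv ℝ k (h ∘ L) x‖ ≤ ‖L‖ ^ k * C := by
  have hC0 : 0 ≤ C := (abs_nonneg _).trans (hC 0)
  refine ContinuousMultilinearMap.opNorm_le_bound (by positivity) fun y => ?_
  rw [iteratedFDeriv_comp_dual_apply hs, norm_mul, norm_prod]
  calc (∏ i, ‖L (y i)‖) * ‖iteratedDeriv k h (L x)‖ ≤ (∏ i, (‖L‖ * ‖y i‖)) * C := by
        gcongr with i
        · exact L.le_opNorm _
        · exact hC _
    _ = ‖L‖ ^ k * C * ∏ i, ‖y i‖ := by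
        simp only [Finset.prod_mul_distrib, Finset.prod_const, Finset.card_univ, Fintype.card_fin]
        ring

namespace SmoothCyl

/-- The smooth cylindrical variable `h(B(ψ))` depending on a single element `ψ` of `𝓗`. -/
noncomputable def single (ψ : hilb B P T) (h : ℝ → ℝ) (hs : ContDiff ℝ (⊤ : ℕ∞) h)
    (hb : ∀ k, ∃ C, ∀ x, |iteratedDeriv k h x| ≤ C) : SmoothCyl B P T where
  m := 1
  f := h ∘ (ContinuousLinearMap.proj 0 : StrongDual ℝ (Fin 1 → ℝ))
  φ := fun _ => ψ
  smooth := hs.comp (contDiff_apply ℝ ℝ 0)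
  bounded k :=
    let ⟨_, hC⟩ := hb k
    ⟨_, norm_iteratedFDeriv_comp_dual_le (hs.of_le (mod_cast le_top)) hC _⟩

theorem val_single (ψ : hilb B P T) {h : ℝ → ℝ} (hs : ContDiff ℝ (⊤ : ℕ∞) h)
    (hb : ∀ k, ∃ C, ∀ x, |iteratedDeriv k h x| ≤ C) (ω : Ω) :
    (single ψ h hs hb).val ω = h ((ψ : Lp ℝ 2 P) ω) := rfl

theorem malliavin_single [IsProbabilityMeasure P] (ψ : hilb B P T) {h : ℝ → ℝ}
    (hs : ContDiff ℝ (⊤ : ℕ∞) h) (hb : ∀ k, ∃ C, ∀ x, |iteratedDeriv k h x| ≤ C) (n : ℕ) (ω : Ω) :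
    (single ψ h hs hb).malliavin n ω =
      iteratedDeriv n h ((ψ : Lp ℝ 2 P) ω) • tensor fun _ => ψ := by
  refine (Fintype.sum_unique (ι := Fin n → Fin 1) _).trans (congrArg (· • _) ?_)
  refine (iteratedFDeriv_comp_dual_apply (hs.of_le (mod_cast le_top)) _ _ _).trans ?_
  refine (congrArg (· * _) (Finset.prod_eq_one fun j _ => ?_)).trans (one_mul _)
  exact Pi.single_eq_same (M := fun _ => ℝ) 0 1

theorem aemeasurable_point (F : SmoothCyl B P T) : AEMeasurable F.point P :=
  aemeasurable_pi_lambda _ fun i =>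
    (Lp.stronglyMeasurable (F.φ i : Lp ℝ 2 P)).measurable.aemeasurable

theorem integrable_val_mul [IsFiniteMeasure P] (F : SmoothCyl B P T) (G : Lp ℝ 2 P) :
    Integrable (fun ω => F.val ω * G ω) P := by
  obtain ⟨C, hC⟩ := F.bounded 0
  exact ((Lp.memLp G).integrable one_le_two).bdd_mul
    (F.smooth.continuous.measurable.comp_aemeasurable F.aemeasurable_point).aestronglyMeasurable
    (.of_forall fun ω => by simpa [val] using hC (F.point ω))

theorem integrable_inner_malliavin [IsProbabilityMeasure P] (F : SmoothCyl B P T) {n : ℕ}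
    (g : tensorPow B P T n) : Integrable (fun ω => inner ℝ (F.malliavin n ω) g) P := by
  simp only [malliavin, sum_inner]
  refine integrable_finsetSum _ fun i _ => ?_
  obtain ⟨C, hC⟩ := F.bounded n
  have hcont : Continuous fun x =>
      iteratedFDeriv ℝ n F.f x fun j => Pi.single (i j) (1 : ℝ) :=
    (ContinuousMultilinearMap.apply ℝ (fun _ : Fin n => Fin F.m → ℝ) ℝ _).continuous.comp
      (F.smooth.continuous_iteratedFDeriv (m := n) (mod_cast le_top))
  have hint : Integrable
      (fun ω => iteratedFDeriv ℝ n F.f (F.point ω) fun j => Pi.single (i j) (1 : ℝ)) P := by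
    refine .of_bound
      (hcont.measurable.comp_aemeasurable F.aemeasurable_point).aestronglyMeasurable
      (C * ∏ j, ‖(Pi.single (i j) 1 : Fin F.m → ℝ)‖) (.of_forall fun ω => ?_)
    exact ((iteratedFDeriv ℝ n F.f (F.point ω)).le_opNorm _).trans (by gcongr; exact hC _)
  refine (hint.mul_const (inner ℝ (tensor fun j => F.φ (i j)) g)).congr (.of_forall fun ω => ?_)
  exact (real_inner_smul_left (F := tensorPow B P T n) _ _ _).symm

theorem inner_malliavin_tensor [IsProbabilityMeasure P] (F : SmoothCyl B P T) (n : ℕ) (ω : Ω)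
    (ψ : hilb B P T) :
    inner ℝ (F.malliavin n ω) (tensor fun _ : Fin n => ψ) =
      iteratedFDeriv ℝ n F.f (F.point ω) fun _ i => inner ℝ (F.φ i) ψ := by
  have hv : (fun i => inner ℝ (F.φ i) ψ) =
      ∑ i, (inner ℝ (F.φ i) ψ : ℝ) • (Pi.single i 1 : Fin F.m → ℝ) := by
    ext j
    simp [Finset.sum_apply, Pi.single_apply]
  rw [hv, ContinuousMultilinearMap.map_sum, malliavin, sum_inner]
  refine Finset.sum_congr rfl fun i _ => ?_
  rw [ContinuousMultilinearMap.map_smul_univ, smul_eq_mul, mul_comm]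
  refine (real_inner_smul_left (F := tensorPow B P T n) _ _ _).trans ?_
  rw [Submodule.coe_inner, tensor, tensor, inner_tensorLp]
  rfl

theorem integral_val_mul_realHermite (hB : IsGaussianProcess B P)
    (hB0 : ∀ t, ∫ ω, B t ω ∂P = 0) [IsProbabilityMeasure P] (F : SmoothCyl B P T)
    {u : hilb B P T} (hu : ‖u‖ = 1) (n : ℕ) :
    ∫ ω, F.val ω * (realHermite n).eval ((u : Lp ℝ 2 P) ω) ∂P =
      ∫ ω, inner ℝ (F.malliavin n ω) (tensor fun _ => u) ∂P := by
  let w : Fin F.m → ℝ := fun i => inner ℝ (F.φ i) u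
  let Z : Fin F.m → hilb B P T := fun i => F.φ i - w i • u
  have hZu (i : Fin F.m) : inner ℝ (Z i) u = 0 := by
    rw [inner_sub_left]
    refine sub_eq_zero.2 (Eq.symm ?_)
    refine (real_inner_smul_left (F := hilb B P T) _ _ _).trans ?_
    rw [real_inner_self_eq_norm_sq, hu, one_pow, mul_one]
  have hpoint : ∀ᵐ ω ∂P, F.point ω = (fun i => (Z i : Lp ℝ 2 P) ω) + (u : Lp ℝ 2 P) ω • w := by
    have hZ : ∀ᵐ ω ∂P, ∀ i, (Z i : Lp ℝ 2 P) ω = (F.φ i : Lp ℝ 2 P) ω - w i * (u : Lp ℝ 2 P) ω :=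
      ae_all_iff.2 fun i => by
        filter_upwards [Lp.coeFn_sub (F.φ i : Lp ℝ 2 P) (w i • (u : Lp ℝ 2 P)),
          Lp.coeFn_smul (w i) (u : Lp ℝ 2 P)] with ω hsub hsmul
        exact hsub.trans (congrArg ((F.φ i : Lp ℝ 2 P) ω - ·) hsmul)
    filter_upwards [hZ] with ω hω
    ext i
    simp [point, hω, mul_comm]
  have parts := integral_mul_realHermite_of_indepFun (P := P)
    (aemeasurable_pi_lambda _ fun i =>
      (Lp.stronglyMeasurable (Z i : Lp ℝ 2 P)).measurable.aemeasurable)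
    (measurePreserving_of_norm_eq_one hB hB0 hu) (indepFun_of_inner_eq_zero hB hB0 Z u hZu)
    F.smooth F.bounded n w
  simp only [inner_malliavin_tensor]
  refine Eq.trans (integral_congr_ae ?_) (parts.trans (integral_congr_ae ?_)) <;>
    filter_upwards [hpoint] with ω hω <;> simp only [val, hω, w]

end SmoothCyl

end Cylinders

section Chaos

variable {Ω : Type*} [MeasurableSpace Ω] {P : Measure Ω} {B : ℝ≥0 → Ω → ℝ} {T : ℝ≥0} {n : ℕ}

theorem aestronglyMeasurable_sigmaAlg_of_mem_hilb (hm : ∀ t, Measurable (B t)) {X : Lp ℝ 2 P}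
    (hX : X ∈ hilb B P T) : AEStronglyMeasurable[sigmaAlg B T] X P := by
  have hle : sigmaAlg B T ≤ ‹MeasurableSpace Ω› := iSup_le fun s => (hm s).comap_le
  have hspan : hilb B P T ≤ lpMeas ℝ ℝ (sigmaAlg B T) 2 P := by
    refine Submodule.topologicalClosure_minimal _ (Submodule.span_le.2 ?_)
      (isClosed_aestronglyMeasurable hle)
    rintro Y ⟨s, hs, hY⟩
    have hBs : Measurable[sigmaAlg B T] (B s) :=
      (comap_measurable (B s)).mono
        (le_iSup (fun s : Set.Iic T => MeasurableSpace.comap (B s) _) ⟨s, hs⟩) le_rfl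
    exact ⟨B s, hBs.stronglyMeasurable, hY⟩
  exact mem_lpMeas_iff_aestronglyMeasurable.1 (hspan hX)

variable [IsProbabilityMeasure P]

theorem tensor_smul_const (c : ℝ) (ψ : hilb B P T) :
    (tensor fun _ : Fin n => c • ψ) = c ^ n • tensor fun _ => ψ := by
  refine Subtype.ext (Lp.ext ?_)
  have hsmul : ∀ᵐ x ∂Measure.pi fun _ : Fin n => P, ∀ j, ((c • ψ : hilb B P T) : Lp ℝ 2 P) (x j) =
      c * (ψ : Lp ℝ 2 P) (x j) := ae_all_iff.2 fun j =>
    (Measure.quasiMeasurePreserving_eval (fun _ : Fin n => P) j).ae_eq_comp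
      (Lp.coeFn_smul c (ψ : Lp ℝ 2 P))
  filter_upwards [hsmul, Lp.coeFn_smul (c ^ n) (tensorLp P fun _ : Fin n => (ψ : Lp ℝ 2 P)),
    (memLp_tensor P fun _ : Fin n => ((c • ψ : hilb B P T) : Lp ℝ 2 P)).coeFn_toLp,
    (memLp_tensor P fun _ : Fin n => (ψ : Lp ℝ 2 P)).coeFn_toLp] with x hx hpow hleft hright
  refine hleft.trans (Eq.trans ?_ hpow.symm)
  rw [Pi.smul_apply, tensorLp, hright]
  simp only [hx, Finset.prod_mul_distrib, Finset.prod_const, Finset.card_univ, Fintype.card_fin,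
    smul_eq_mul]

theorem inner_tensor_const (φ ψ : hilb B P T) :
    inner ℝ (tensor fun _ : Fin n => φ) (tensor fun _ => ψ) = inner ℝ φ ψ ^ n := by
  rw [Submodule.coe_inner, tensor, tensor, inner_tensorLp]
  simp

namespace IsMultipleIntegral

variable {g g' : tensorPow B P T n} {G G' : Lp ℝ 2 P}

theorem sub (hG : IsMultipleIntegral B P T n g G) (hG' : IsMultipleIntegral B P T n g' G') :
    IsMultipleIntegral B P T n (g - g') (G - G') := by
  refine ⟨(hG.1.sub hG'.1).congr (Lp.coeFn_sub G G').symm, fun F => ?_⟩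
  simp only [inner_sub_right]
  rw [integral_sub (F.integrable_inner_malliavin g) (F.integrable_inner_malliavin g'), ← hG.2,
    ← hG'.2, ← integral_sub (F.integrable_val_mul G) (F.integrable_val_mul G')]
  refine integral_congr_ae ?_
  filter_upwards [Lp.coeFn_sub G G'] with ω hω
  rw [hω, Pi.sub_apply, mul_sub]

theorem smul (hG : IsMultipleIntegral B P T n g G) (c : ℝ) :
    IsMultipleIntegral B P T n (c • g) (c • G) := by
  refine ⟨(hG.1.const_smul c).congr (Lp.coeFn_smul c G).symm, fun F => ?_⟩
  have inner_smul (ω : Ω) : inner ℝ (F.malliavin n ω) (c • g) = c * inner ℝ (F.malliavin n ω) g :=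
    real_inner_smul_right (F := tensorPow B P T n) _ _ _
  simp only [inner_smul]
  rw [integral_const_mul, ← hG.2, ← integral_const_mul]
  refine integral_congr_ae ?_
  filter_upwards [Lp.coeFn_smul c G] with ω hω
  rw [hω, Pi.smul_apply, smul_eq_mul, mul_left_comm]

theorem integral_comp_mul (hG : IsMultipleIntegral B P T n g G) (ψ : hilb B P T) {h : ℝ → ℝ}
    (hs : ContDiff ℝ (⊤ : ℕ∞) h) (hb : ∀ k, ∃ C, ∀ x, |iteratedDeriv k h x| ≤ C) :
    ∫ ω, h ((ψ : Lp ℝ 2 P) ω) * G ω ∂P =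
      (∫ ω, iteratedDeriv n h ((ψ : Lp ℝ 2 P) ω) ∂P) * inner ℝ (tensor fun _ => ψ) g := by
  have hF := hG.2 (.single ψ h hs hb)
  simp only [SmoothCyl.val_single, SmoothCyl.malliavin_single] at hF
  rw [hF, ← integral_mul_const]
  congr with ω
  exact real_inner_smul_left (F := tensorPow B P T n) _ _ _

theorem integral_smul_exp_eq_zero (hG : IsMultipleIntegral B P T n g G) {ψ : hilb B P T}
    (hψ : inner ℝ (tensor fun _ => ψ) g = 0) :
    ∫ ω, G ω • Complex.exp ((ψ : Lp ℝ 2 P) ω * Complex.I) ∂P = 0 := by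
  refine integral_smul_exp_mul_I_eq_zero ((Lp.memLp G).integrable one_le_two)
    (Lp.stronglyMeasurable _).measurable.aemeasurable ?_ ?_
  · rw [hG.integral_comp_mul ψ Real.contDiff_cos
      fun k => ⟨1, Real.abs_iteratedDeriv_cos_le_one k⟩, hψ, mul_zero]
  · rw [hG.integral_comp_mul ψ Real.contDiff_sin
      fun k => ⟨1, Real.abs_iteratedDeriv_sin_le_one k⟩, hψ, mul_zero]

/- The trigonometric functions of `B(c • u)`, `c : ℝ`, see `g` only through the coefficient
`⟨u^{⊗ n}, g⟩`, and they determine the conditional expectation of `G` given `B(u)`. -/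
theorem inner_compMeasurePreserving_eq_zero (hG : IsMultipleIntegral B P T n g G)
    {u : hilb B P T} (hu : MeasurePreserving (u : Lp ℝ 2 P) P γ)
    (hug : inner ℝ (tensor fun _ => u) g = 0) (f : Lp ℝ 2 γ) :
    inner ℝ (Lp.compMeasurePreserving u hu f) G = 0 := by
  have hexp (L : StrongDual ℝ ℝ) :
      ∫ ω, G ω • Complex.exp (L ((u : Lp ℝ 2 P) ω) * Complex.I) ∂P = 0 := by
    have hLu : inner ℝ (tensor fun _ => L 1 • u) g = 0 := by
      rw [tensor_smul_const]
      exact (real_inner_smul_left (F := tensorPow B P T n) _ _ _).trans (by rw [hug, mul_zero])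
    rw [← hG.integral_smul_exp_eq_zero hLu]
    refine integral_congr_ae ?_
    filter_upwards [Lp.coeFn_smul (L 1) (u : Lp ℝ 2 P)] with ω hω
    have hL : L ((u : Lp ℝ 2 P) ω) = (L 1 • u : hilb B P T).1 ω := by
      rw [Submodule.coe_smul, hω, Pi.smul_apply, smul_eq_mul, mul_comm, ← smul_eq_mul, ← map_smul,
        smul_eq_mul, mul_one]
    rw [hL]
  have hae := Lp.coeFn_compMeasurePreserving f hu
  have hmul : (fun ω => G ω • f ((u : Lp ℝ 2 P) ω)) =ᵐ[P]
      fun ω => inner ℝ (Lp.compMeasurePreserving u hu f ω) (G ω) := by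
    filter_upwards [hae] with ω hω
    rw [Real.inner_apply, hω, Function.comp_apply, smul_eq_mul, mul_comm]
  rw [L2.inner_def, ← integral_congr_ae hmul]
  exact integral_smul_comp_eq_zero_of_integral_smul_exp_eq_zero
    ((Lp.memLp G).integrable one_le_two) hu.measurable hexp (Lp.stronglyMeasurable f)
    ((L2.integrable_inner _ _).congr hmul.symm)

theorem eq_zero (hm : ∀ t, Measurable (B t)) (hB : ∀ t, MemLp (B t) 2 P)
    (hG : IsMultipleIntegral B P T n 0 G) : G = 0 := by
  classical
  rw [Lp.eq_zero_iff_ae_eq_zero]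
  refine ae_eq_zero_of_integral_smul_exp_eq_zero ((Lp.memLp G).integrable one_le_two)
    (fun s : Set.Iic T => hm s) hG.1 fun I L => ?_
  let ψ (s : Set.Iic T) : hilb B P T := ⟨(hB s).toLp (B s),
    Submodule.le_topologicalClosure _ (Submodule.subset_span ⟨s, s.2, (hB s).coeFn_toLp⟩)⟩
  rw [← hG.integral_smul_exp_eq_zero (ψ := ∑ s, L (Pi.single s 1) • ψ s) (inner_zero_right _)]
  have hψ : ∀ᵐ ω ∂P, ∀ s : I, (ψ s : Lp ℝ 2 P) ω = B s ω :=
    ae_all_iff.2 fun s => (hB s).coeFn_toLp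
  refine integral_congr_ae ?_
  filter_upwards [coeFn_sum_dual_smul (fun s : I => (ψ s : Lp ℝ 2 P)) L, hψ] with ω hL hω
  rw [Submodule.coe_sum]
  simp only [Submodule.coe_smul, hL, hω]

theorem unique (hm : ∀ t, Measurable (B t)) (hB : ∀ t, MemLp (B t) 2 P)
    (hG : IsMultipleIntegral B P T n g G) (hG' : IsMultipleIntegral B P T n g G') : G = G' :=
  sub_eq_zero.1 ((sub_self g ▸ hG.sub hG').eq_zero hm hB)

theorem multipleIntegral_eq (hm : ∀ t, Measurable (B t)) (hB : ∀ t, MemLp (B t) 2 P)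
    (hG : IsMultipleIntegral B P T n g G) : multipleIntegral B P T n g = G := by
  have hex : ∃ G, IsMultipleIntegral B P T n g G := ⟨G, hG⟩
  rw [multipleIntegral, dif_pos hex]
  exact hex.choose_spec.unique hm hB hG

end IsMultipleIntegral

theorem isMultipleIntegral_hermiteLp (hm : ∀ t, Measurable (B t)) (hB : IsGaussianProcess B P)
    (hB0 : ∀ t, ∫ ω, B t ω ∂P = 0) {u : hilb B P T} (hu : ‖u‖ = 1) (n : ℕ) :
    IsMultipleIntegral B P T n (tensor fun _ => u)
      (Lp.compMeasurePreserving u (measurePreserving_of_norm_eq_one hB hB0 hu) (hermiteLp n)) := by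
  have hu' := measurePreserving_of_norm_eq_one hB hB0 hu
  have hae : Lp.compMeasurePreserving u hu' (hermiteLp n) =ᵐ[P]
      fun ω => (realHermite n).eval ((u : Lp ℝ 2 P) ω) :=
    (Lp.coeFn_compMeasurePreserving _ hu').trans
      (hu'.quasiMeasurePreserving.ae_eq_comp (coeFn_hermiteLp n))
  refine ⟨((realHermite n).continuous.comp_aestronglyMeasurable
    (aestronglyMeasurable_sigmaAlg_of_mem_hilb hm u.2)).congr hae.symm, fun F => ?_⟩
  rw [← F.integral_val_mul_realHermite hB hB0 hu]
  exact integral_congr_ae (hae.mono fun ω hω => by simp only [hω])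

end Chaos

section Sign

variable {Ω : Type*} [MeasurableSpace Ω] {P : Measure Ω} [IsProbabilityMeasure P]
  {B : ℝ≥0 → Ω → ℝ} {T : ℝ≥0} {n : ℕ}

theorem signLp_congr {μ : Measure Ω} [IsFiniteMeasure μ] {X Y : Ω → ℝ} {hX : AEMeasurable X μ}
    {hY : AEMeasurable Y μ} (h : ∀ᵐ ω ∂μ, (X ω).sign = (Y ω).sign) : signLp hX = signLp hY :=
  (MemLp.toLp_eq_toLp_iff _ _).2 h

theorem compMeasurePreserving_signLp {μ : Measure Ω} [IsFiniteMeasure μ] {X : Ω → ℝ}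
    (hX : MeasurePreserving X μ γ) :
    Lp.compMeasurePreserving X hX (signLp (μ := γ) aemeasurable_id) = signLp hX.aemeasurable :=
  Lp.toLp_compMeasurePreserving _ hX

theorem sign_mul_of_pos {c : ℝ} (hc : 0 < c) (x : ℝ) : (c * x).sign = x.sign := by
  rcases lt_trichotomy x 0 with hx | rfl | hx
  · rw [Real.sign_of_neg hx, Real.sign_of_neg (mul_neg_of_pos_of_neg hc hx)]
  · rw [mul_zero]
  · rw [Real.sign_of_pos hx, Real.sign_of_pos (mul_pos hc hx)]

theorem signLp_smul {μ : Measure Ω} [IsFiniteMeasure μ] {c : ℝ} (hc : 0 < c) (X : Lp ℝ 2 μ) :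
    signLp (Lp.aestronglyMeasurable (c • X)).aemeasurable =
      signLp (Lp.aestronglyMeasurable X).aemeasurable :=
  signLp_congr <| by
    filter_upwards [Lp.coeFn_smul c X] with ω hω
    rw [hω, Pi.smul_apply, smul_eq_mul, sign_mul_of_pos hc]

theorem isMultipleIntegral_smul_hermiteLp (hm : ∀ t, Measurable (B t))
    (hB : IsGaussianProcess B P) (hB0 : ∀ t, ∫ ω, B t ω ∂P = 0) {u : hilb B P T} (hu : ‖u‖ = 1)
    (c : ℝ) (n : ℕ) :
    IsMultipleIntegral B P T n (tensor fun _ => c • u) (c ^ n •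
      Lp.compMeasurePreserving u (measurePreserving_of_norm_eq_one hB hB0 hu) (hermiteLp n)) := by
  rw [tensor_smul_const]
  exact (isMultipleIntegral_hermiteLp hm hB hB0 hu n).smul _

theorem hasSum_signCoeff_smul_multipleIntegral (hm : ∀ t, Measurable (B t))
    (hB : IsGaussianProcess B P) (hB0 : ∀ t, ∫ ω, B t ω ∂P = 0) {u : hilb B P T} (hu : ‖u‖ = 1)
    {c : ℝ} (hc : 0 < c) :
    HasSum (fun k => (signCoeff k / c ^ (2 * k + 1)) •
        multipleIntegral B P T (2 * k + 1) (tensor fun _ => c • u))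
      (signLp (Lp.aestronglyMeasurable (u : Lp ℝ 2 P)).aemeasurable) := by
  have hu' := measurePreserving_of_norm_eq_one hB hB0 hu
  have integral_eq (n : ℕ) : multipleIntegral B P T n (tensor fun _ => c • u) =
      c ^ n • Lp.compMeasurePreserving u hu' (hermiteLp n) :=
    (isMultipleIntegral_smul_hermiteLp hm hB hB0 hu c n).multipleIntegral_eq hm
      fun t => (hB.hasGaussianLaw_eval t).memLp_two
  let pull : Lp ℝ 2 γ →ₗᵢ[ℝ] Lp ℝ 2 P := Lp.compMeasurePreservingₗᵢ ℝ _ hu'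
  have pull_signLp : pull (signLp aemeasurable_id) =
      signLp (Lp.aestronglyMeasurable (u : Lp ℝ 2 P)).aemeasurable :=
    compMeasurePreserving_signLp hu'
  rw [← pull_signLp]
  convert pull.toContinuousLinearMap.hasSum hasSum_signCoeff_smul_hermiteLp using 2 with k
  · rw [integral_eq, smul_smul, div_mul_cancel₀ _ (by positivity), map_smul]
    rfl
  · rfl

theorem IsMultipleIntegral.inner_compMeasurePreserving {g : tensorPow B P T n} {G : Lp ℝ 2 P}
    (hG : IsMultipleIntegral B P T n g G) (hm : ∀ t, Measurable (B t))
    (hB : IsGaussianProcess B P) (hB0 : ∀ t, ∫ ω, B t ω ∂P = 0) {u : hilb B P T} (hu : ‖u‖ = 1)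
    (f : Lp ℝ 2 γ) :
    inner ℝ (Lp.compMeasurePreserving u (measurePreserving_of_norm_eq_one hB hB0 hu) f) G =
      inner ℝ (tensor fun _ => u) g * inner ℝ f (hermiteLp n) := by
  have hu' := measurePreserving_of_norm_eq_one hB hB0 hu
  set a : ℝ := inner ℝ (tensor fun _ => u) g
  have horth : inner ℝ (tensor fun _ => u) (g - a • tensor fun _ => u) = 0 := by
    rw [inner_sub_right, sub_eq_zero]
    refine Eq.symm ((real_inner_smul_right (F := tensorPow B P T n) _ _ _).trans ?_)
    rw [inner_tensor_const, real_inner_self_eq_norm_sq, hu, one_pow, one_pow, mul_one]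
  have hzero := (hG.sub ((isMultipleIntegral_hermiteLp hm hB hB0 hu n).smul
    a)).inner_compMeasurePreserving_eq_zero hu' horth f
  rw [inner_sub_right, sub_eq_zero, real_inner_smul_right] at hzero
  exact hzero.trans (congrArg (a * ·) ((Lp.compMeasurePreservingₗᵢ ℝ _ hu').inner_map_map f _))

end Sign

end

namespace IsFBM

variable {Ω : Type*} [MeasurableSpace Ω] {P : Measure Ω} {B : ℝ≥0 → Ω → ℝ} {H : ℝ} {t T : ℝ≥0}

theorem norm_ind (hB : IsFBM H B P) (hH : 0 < H) (htT : t ≤ T) :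
    ‖hB.ind htT‖ = (t : ℝ) ^ H := by
  have hsq : ‖hB.ind htT‖ ^ 2 = ((t : ℝ) ^ H) ^ 2 := by
    rw [← real_inner_self_eq_norm_sq, hB.inner_ind, cov, sub_self, abs_zero,
      Real.zero_rpow (by positivity), sub_zero, add_self_div_two, mul_comm 2 H,
      Real.rpow_mul t.coe_nonneg, Real.rpow_two]
  exact (sq_eq_sq₀ (norm_nonneg _) (by positivity)).1 hsq

theorem ind_ne_zero (hB : IsFBM H B P) (hH : 0 < H) (ht : 0 < t) (htT : t ≤ T) :
    hB.ind htT ≠ 0 :=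
  norm_ne_zero_iff.1 (by rw [hB.norm_ind hH]; positivity)

theorem sign_eq_signLp_ind [IsProbabilityMeasure P] (hB : IsFBM H B P) (htT : t ≤ T) :
    hB.sign t = signLp (Lp.aestronglyMeasurable (hB.ind htT : Lp ℝ 2 P)).aemeasurable :=
  signLp_congr (hX := (hB.measurable t).aemeasurable)
    ((hB.memLp t).coeFn_toLp.mono fun _ h => congrArg Real.sign h.symm)

end IsFBM

theorem coeff_eq_signCoeff_div (H : ℝ) (t : ℝ≥0) (k : ℕ) :
    coeff H t k = signCoeff k / ((t : ℝ) ^ H) ^ (2 * k + 1) := by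
  have hpow : (t : ℝ) ^ ((2 * k + 1) * H) = ((t : ℝ) ^ H) ^ (2 * k + 1) := by
    rw [mul_comm, Real.rpow_mul t.coe_nonneg, ← Real.rpow_natCast]
    push_cast
    rfl
  rw [coeff, hpow, signCoeff, div_div]
  congr 1
  ring

end FBM

theorem mainTheorem6_general {Ω : Type*} [MeasurableSpace Ω] (P : Measure Ω)
    [IsProbabilityMeasure P] (B : ℝ≥0 → Ω → ℝ) (hm : ∀ t, Measurable (B t))
    (hB : IsGaussianProcess B P) (hB0 : ∀ t, ∫ ω, B t ω ∂P = 0) (T : ℝ≥0)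
    (φ : FBM.hilb B P T) (hφ : φ ≠ 0) :
    (∀ n : ℕ, ∃! G : Lp ℝ 2 P, FBM.IsMultipleIntegral B P T n (FBM.tensor fun _ => φ) G) ∧
    HasSum (fun k : ℕ => (FBM.signCoeff k / ‖φ‖ ^ (2 * k + 1)) •
        FBM.multipleIntegral B P T (2 * k + 1) (FBM.tensor fun _ => φ))
      (FBM.signLp (Lp.aestronglyMeasurable (φ : Lp ℝ 2 P)).aemeasurable) ∧
    (∀ n : ℕ, Even n → ∀ G ∈ FBM.chaos B P T n,
      inner ℝ (FBM.signLp (Lp.aestronglyMeasurable (φ : Lp ℝ 2 P)).aemeasurable) G = 0) := by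
  obtain ⟨c, u, hc, hu, rfl⟩ : ∃ (c : ℝ) (u : FBM.hilb B P T), 0 < c ∧ ‖u‖ = 1 ∧ φ = c • u := by
    have hpos : 0 < ‖φ‖ := norm_pos_iff.2 hφ
    refine ⟨‖φ‖, ‖φ‖⁻¹ • φ, hpos, ?_, (smul_inv_smul₀ hpos.ne' φ).symm⟩
    rw [norm_smul, norm_inv, norm_norm, inv_mul_cancel₀ hpos.ne']
  have hI := FBM.isMultipleIntegral_smul_hermiteLp hm hB hB0 hu c
  have norm_eq : ‖c • u‖ = c := by rw [norm_smul, hu, mul_one, Real.norm_of_nonneg hc.le]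
  rw [norm_eq, Submodule.coe_smul, FBM.signLp_smul hc]
  refine ⟨fun n => ⟨_, hI n, fun G hG =>
    hG.unique hm (fun t => (hB.hasGaussianLaw_eval t).memLp_two) (hI n)⟩,
    FBM.hasSum_signCoeff_smul_multipleIntegral hm hB hB0 hu hc, ?_⟩
  rintro n hn G ⟨g, hG⟩
  rw [← FBM.compMeasurePreserving_signLp (FBM.measurePreserving_of_norm_eq_one hB hB0 hu),
    hG.inner_compMeasurePreserving hm hB hB0 hu, FBM.inner_signLp_hermiteLp,
    FBM.integral_sign_mul_realHermite_of_even hn, mul_zero]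

/-- Chaos expansion of `sign(B_t)`: the integrals `Iₙ(1_{[0,t]}^{⊗ n})` are well defined,
`sign(B_t) = ∑ₖ b_{2k+1} I_{2k+1}(1_{[0,t]}^{⊗ (2k+1)})` in `L²`, and `sign(B_t)` has no component
in the Wiener chaoses of even order. -/
theorem mainTheorem6 {Ω : Type*} [MeasurableSpace Ω] (P : Measure Ω) [IsProbabilityMeasure P]
    (H : ℝ) (hH0 : 0 < H) (hH1 : H < 1) (B : ℝ≥0 → Ω → ℝ) (hB : FBM.IsFBM H B P)
    (t T : ℝ≥0) (ht : 0 < t) (htT : t ≤ T) :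
    (∀ n : ℕ, ∃! G : Lp ℝ 2 P,
      FBM.IsMultipleIntegral B P T n (FBM.tensor fun _ => hB.ind htT) G) ∧
    HasSum (fun k : ℕ => FBM.coeff H t k •
      FBM.multipleIntegral B P T (2 * k + 1) (FBM.tensor fun _ => hB.ind htT)) (hB.sign t) ∧
    (∀ n : ℕ, Even n → ∀ G ∈ FBM.chaos B P T n, inner ℝ (hB.sign t) G = 0) := by
  simpa only [hB.norm_ind hH0, ← FBM.coeff_eq_signCoeff_div, ← hB.sign_eq_signLp_ind htT] using
    mainTheorem6_general P B hB.measurable hB.gaussian hB.mean_zero T _ (hB.ind_ne_zero hH0 ht htT)
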